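/- Let $H\in(0,1)$ with $H\neq\frac34$. For $T>0$ let $\mathfrak H=\mathfrak H_T$ be the canonical Hilbert space of fractional Brownian motion with Hurst parameter $H$ on $[0,T]$, i.e. the completion of the real step functions on $[0,T]$ with respect to the (semi-)inner product determined by $$\langle \mathbf 1_{[0,s]},\mathbf 1_{[0,t]}\rangle_{\mathfrak H}=R(s,t)=\tfrac12\big(s^{2H}+t^{2H}-|s-t|^{2H}\big),\qquad s,t\in[0,T],$$ and let $\mathfrak H^{\otimes2}$ be its Hilbert space tensor square. A function $f$ on $[0,T]^2$ is regarded as the element of $\mathfrak H^{\otimes 2}$ determined by $$\langle f,\mathbf 1_{[0,a]}\otimes\mathbf 1_{[0,b]}\rangle_{\mathfrak H^{\otimes2}}=\int_{[0,T]^2} f(u,v)\,\frac{\partial R}{\partial u}(u,a)\,\frac{\partial R}{\partial v}(v,b)\,\mathrm du\,\mathrm dv,\qquad a,b\in[0,T].$$ Let $f_T(t,s)=e^{-|t-s|}\mathbf 1_{\{0\le s,t\le T\}}$ and $$\sigma^2=H^2\,\Gamma(2H)^2\,(4H-1)\Big(1-\frac1{\cos(2H\pi)}\Big),$$ where for $H=\frac14$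 the factor $(4H-1)\big(1-\frac1{\cos(2H\pi)}\big)$ is understood as its limit $\frac2\pi$. Then for every $T>0$ the function $f_T$ defines a unique element of $\mathfrak H^{\otimes2}$, and for every $T_0>0$ there is a constant $C>0$, independent of $T$, such that $$\Big|\frac1{2T}\|f_T\|^2_{\mathfrak H^{\otimes2}}-\sigma^2\Big|\le\frac{C}{T^{\,1\wedge(3-4H)}}\qquad\text{for all }T\ge T_0 .$$ If moreover $H<\frac34$, then $C>0$ can be chosen such that this inequality holds for all $T>0$. -/

import Mathlib

open MeasureTheory Set

open scoped TensorProduct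

noncomputable section

namespace FBM

/-- The covariance function `R(s,t) = (s^{2H} + t^{2H} - |s-t|^{2H}) / 2` of fractional Brownian
motion with Hurst parameter `H`. -/
def cov (H s t : ℝ) : ℝ := (|s| ^ (2 * H) + |t| ^ (2 * H) - |s - t| ^ (2 * H)) / 2

theorem cov_comm (H s t : ℝ) : cov H s t = cov H t s := by
  simp only [cov, abs_sub_comm s t]; ring

/-! ### Positive semidefiniteness of the covariance (needed for the inner product) -/

theorem integrableOn_one_sub_cos (H : ℝ) (h0 : 0 < H) (h1 : H < 1) (t : ℝ) :
    IntegrableOn (fun x : ℝ => (1 - Real.cos (t * x)) * x ^ (-1 - 2 * H)) (Ioi 0) := by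
  have hm : Measurable (fun x : ℝ => (1 - Real.cos (t * x)) * x ^ (-1 - 2 * H)) := by fun_prop
  have hu : Ioi (0 : ℝ) = Ioo 0 1 ∪ Ici 1 := by
    ext x; simp only [mem_Ioi, mem_union, mem_Ioo, mem_Ici]
    constructor
    · intro hx
      rcases lt_or_ge x 1 with h | h
      · exact Or.inl ⟨hx, h⟩
      · exact Or.inr h
    · rintro (h | h)
      · exact h.1
      · linarith
  rw [hu]
  refine IntegrableOn.union ?_ ?_
  · have hi : IntegrableOn (fun x : ℝ => t ^ 2 / 2 * x ^ (1 - 2 * H)) (Ioo 0 1) :=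
      ((intervalIntegral.integrableOn_Ioo_rpow_iff one_pos).2 (by linarith)).const_mul _
    refine Integrable.mono' hi hm.aestronglyMeasurable ?_
    refine (ae_restrict_iff' measurableSet_Ioo).2 (Filter.Eventually.of_forall fun x hx => ?_)
    have hx0 : 0 < x := hx.1
    have hp : 0 ≤ x ^ (-1 - 2 * H) := Real.rpow_nonneg hx0.le _
    have hc := Real.one_sub_sq_div_two_le_cos (x := t * x)
    have hc1 := Real.cos_le_one (t * x)
    rw [Real.norm_of_nonneg (mul_nonneg (by linarith) hp)]
    have he : x ^ (1 - 2 * H) = x ^ 2 * x ^ (-1 - 2 * H) := by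
      rw [← Real.rpow_natCast, ← Real.rpow_add hx0]; congr 1; push_cast; ring
    rw [he, ← mul_assoc]
    refine mul_le_mul_of_nonneg_right ?_ hp
    nlinarith
  · rw [integrableOn_Ici_iff_integrableOn_Ioi]
    have hi : IntegrableOn (fun x : ℝ => 2 * x ^ (-1 - 2 * H)) (Ioi 1) :=
      (integrableOn_Ioi_rpow_of_lt (by linarith) one_pos).const_mul _
    refine Integrable.mono' hi hm.aestronglyMeasurable ?_
    refine (ae_restrict_iff' measurableSet_Ioi).2 (Filter.Eventually.of_forall fun x hx => ?_)
    have hx0 : 0 < x := lt_trans one_pos hx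
    have hp : 0 ≤ x ^ (-1 - 2 * H) := Real.rpow_nonneg hx0.le _
    have hc := Real.neg_one_le_cos (t * x)
    have hc1 := Real.cos_le_one (t * x)
    rw [Real.norm_of_nonneg (mul_nonneg (by linarith) hp)]
    exact mul_le_mul_of_nonneg_right (by linarith) hp

theorem integral_one_sub_cos (H : ℝ) (h0 : 0 < H) (t : ℝ) :
    ∫ x in Ioi (0 : ℝ), (1 - Real.cos (t * x)) * x ^ (-1 - 2 * H) =
      |t| ^ (2 * H) * ∫ x in Ioi (0 : ℝ), (1 - Real.cos x) * x ^ (-1 - 2 * H) := by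
  rcases eq_or_ne t 0 with rfl | ht
  · simp [Real.zero_rpow (by linarith : 2 * H ≠ 0)]
  have hp : 0 < |t| := abs_pos.2 ht
  have h := integral_comp_mul_left_Ioi
    (fun x : ℝ => (1 - Real.cos x) * x ^ (-1 - 2 * H)) 0 hp
  rw [mul_zero, smul_eq_mul] at h
  have h2 : ∫ x in Ioi (0 : ℝ), (1 - Real.cos (|t| * x)) * (|t| * x) ^ (-1 - 2 * H) =
      |t| ^ (-1 - 2 * H) *
        ∫ x in Ioi (0 : ℝ), (1 - Real.cos (t * x)) * x ^ (-1 - 2 * H) := by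
    rw [← integral_const_mul]
    refine setIntegral_congr_fun measurableSet_Ioi fun x hx => ?_
    have hx0 : (0 : ℝ) < x := hx
    have hc : Real.cos (|t| * x) = Real.cos (t * x) := by
      rw [← Real.cos_abs (t * x), abs_mul, abs_of_pos hx0]
    simp only [hc, Real.mul_rpow hp.le hx0.le]; ring
  rw [h2] at h
  have h3 : |t| ^ (1 + 2 * H) * |t| ^ (-1 - 2 * H) = 1 := by
    rw [← Real.rpow_add hp]; ring_nf; exact Real.rpow_zero _
  have h4 : |t| ^ (1 + 2 * H) * |t|⁻¹ = |t| ^ (2 * H) := by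
    rw [← Real.rpow_neg_one, ← Real.rpow_add hp]; congr 1; ring
  calc _ = |t| ^ (1 + 2 * H) * (|t| ^ (-1 - 2 * H) *
        ∫ x in Ioi (0 : ℝ), (1 - Real.cos (t * x)) * x ^ (-1 - 2 * H)) := by
        rw [← mul_assoc, h3, one_mul]
    _ = _ := by rw [h, ← mul_assoc, h4]

theorem integral_one_sub_cos_pos (H : ℝ) (h0 : 0 < H) (h1 : H < 1) :
    0 < ∫ x in Ioi (0 : ℝ), (1 - Real.cos x) * x ^ (-1 - 2 * H) := by
  have hi := integrableOn_one_sub_cos H h0 h1 1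
  simp only [one_mul] at hi
  have hnn : ∀ x ∈ Ioi (0 : ℝ), 0 ≤ (1 - Real.cos x) * x ^ (-1 - 2 * H) := fun x hx =>
    mul_nonneg (by linarith [Real.cos_le_one x]) (Real.rpow_nonneg (le_of_lt hx) _)
  rw [setIntegral_pos_iff_support_of_nonneg_ae
    ((ae_restrict_iff' measurableSet_Ioi).2 (Filter.Eventually.of_forall hnn)) hi]
  have hsub : Ioo (0 : ℝ) 1 ⊆
      Function.support (fun x : ℝ => (1 - Real.cos x) * x ^ (-1 - 2 * H)) ∩ Ioi 0 := by
    intro x hx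
    refine ⟨?_, hx.1⟩
    have hlt : Real.cos x < 1 := by
      have := Real.cos_lt_cos_of_nonneg_of_le_pi le_rfl
        (by linarith [hx.2, Real.pi_gt_three] : x ≤ Real.pi) hx.1
      simpa using this
    exact (mul_pos (by linarith) (Real.rpow_pos_of_pos hx.1 _)).ne'
  refine lt_of_lt_of_le ?_ (measure_mono hsub)
  simp

theorem cov_nonneg (H : ℝ) (h0 : 0 < H) (h1 : H < 1) {ι : Type*} (s : Finset ι)
    (a t : ι → ℝ) : 0 ≤ ∑ i ∈ s, ∑ j ∈ s, a i * a j * cov H (t i) (t j) := by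
  set K := ∫ x in Ioi (0 : ℝ), (1 - Real.cos x) * x ^ (-1 - 2 * H) with hK
  have hKpos : 0 < K := integral_one_sub_cos_pos H h0 h1
  have hint := fun r => integrableOn_one_sub_cos H h0 h1 r
  have key : ∀ r q : ℝ, K * (2 * cov H r q) = ∫ x in Ioi (0 : ℝ),
      ((1 - Real.cos (r * x)) * x ^ (-1 - 2 * H) + (1 - Real.cos (q * x)) * x ^ (-1 - 2 * H)
        - (1 - Real.cos ((r - q) * x)) * x ^ (-1 - 2 * H)) := by
    intro r q
    have hrq : Integrable (fun x : ℝ => (1 - Real.cos (r * x)) * x ^ (-1 - 2 * H) +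
        (1 - Real.cos (q * x)) * x ^ (-1 - 2 * H)) (volume.restrict (Ioi (0 : ℝ))) :=
      (hint r).add (hint q)
    rw [integral_sub hrq (hint (r - q)), integral_add (hint r) (hint q),
      integral_one_sub_cos H h0, integral_one_sub_cos H h0, integral_one_sub_cos H h0, ← hK]
    simp only [cov]; ring
  have hsum : K * 2 * ∑ i ∈ s, ∑ j ∈ s, a i * a j * cov H (t i) (t j) =
      ∫ x in Ioi (0 : ℝ), ∑ i ∈ s, ∑ j ∈ s, a i * a j *
        ((1 - Real.cos (t i * x)) * x ^ (-1 - 2 * H)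
          + (1 - Real.cos (t j * x)) * x ^ (-1 - 2 * H)
          - (1 - Real.cos ((t i - t j) * x)) * x ^ (-1 - 2 * H)) := by
    have hi : ∀ i j, Integrable (fun x : ℝ => a i * a j *
        ((1 - Real.cos (t i * x)) * x ^ (-1 - 2 * H)
          + (1 - Real.cos (t j * x)) * x ^ (-1 - 2 * H)
          - (1 - Real.cos ((t i - t j) * x)) * x ^ (-1 - 2 * H)))
        (volume.restrict (Ioi (0 : ℝ))) := fun i j =>
      (((hint (t i)).add (hint (t j))).sub (hint (t i - t j))).const_mul _
    rw [integral_finsetSum _ (fun i _ => integrable_finsetSum _ fun j _ => hi i j),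
      Finset.mul_sum]
    refine Finset.sum_congr rfl fun i _ => ?_
    rw [integral_finsetSum _ (fun j _ => hi i j), Finset.mul_sum]
    refine Finset.sum_congr rfl fun j _ => ?_
    rw [integral_const_mul, ← key]; ring
  have hnn : 0 ≤ K * 2 * ∑ i ∈ s, ∑ j ∈ s, a i * a j * cov H (t i) (t j) := by
    rw [hsum]
    refine setIntegral_nonneg measurableSet_Ioi fun x hx => ?_
    have he : ∑ i ∈ s, ∑ j ∈ s, a i * a j *
        ((1 - Real.cos (t i * x)) * x ^ (-1 - 2 * H)
          + (1 - Real.cos (t j * x)) * x ^ (-1 - 2 * H)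
          - (1 - Real.cos ((t i - t j) * x)) * x ^ (-1 - 2 * H)) =
        ((∑ i ∈ s, a i * (1 - Real.cos (t i * x))) * (∑ i ∈ s, a i * (1 - Real.cos (t i * x)))
          + (∑ i ∈ s, a i * Real.sin (t i * x)) * (∑ i ∈ s, a i * Real.sin (t i * x)))
            * x ^ (-1 - 2 * H) := by
      rw [Finset.sum_mul_sum, Finset.sum_mul_sum, ← Finset.sum_add_distrib, Finset.sum_mul]
      refine Finset.sum_congr rfl fun i _ => ?_
      rw [← Finset.sum_add_distrib, Finset.sum_mul]
      refine Finset.sum_congr rfl fun j _ => ?_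
      rw [sub_mul (t i), Real.cos_sub]; ring
    rw [he]
    exact mul_nonneg (add_nonneg (mul_self_nonneg _) (mul_self_nonneg _))
      (Real.rpow_nonneg (le_of_lt hx) _)
  exact nonneg_of_mul_nonneg_right hnn (by positivity)

/-! ### The canonical Hilbert space on `[0,T]` and its tensor square -/

/-- Step functions on `[0,T]`: finite linear combinations `∑ᵢ aᵢ 1_[0,tᵢ]`, `tᵢ ∈ [0,T]`, encoded
by their coefficients (`Finsupp.single t 1` stands for `1_[0,t]`). -/
def Step (_H : Ioo (0 : ℝ) 1) (T : ℝ) : Type := Icc (0 : ℝ) T →₀ ℝ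

variable (H : Ioo (0 : ℝ) 1) (T : ℝ)

instance : AddCommGroup (Step H T) := inferInstanceAs (AddCommGroup (Icc (0 : ℝ) T →₀ ℝ))

instance : Module ℝ (Step H T) := inferInstanceAs (Module ℝ (Icc (0 : ℝ) T →₀ ℝ))

/-- The bilinear form on step functions determined by `⟨1_[0,s], 1_[0,t]⟩ = R(s,t)`. -/
def stepForm (x y : Icc (0 : ℝ) T →₀ ℝ) : ℝ :=
  x.sum fun s a => y.sum fun t b => a * b * cov H s t

theorem stepForm_comm (x y : Icc (0 : ℝ) T →₀ ℝ) : stepForm H T y x = stepForm H T x y := by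
  unfold stepForm
  rw [Finsupp.sum_comm]
  refine Finsupp.sum_congr fun s _ => Finsupp.sum_congr fun t _ => ?_
  rw [cov_comm]; ring

theorem stepForm_nonneg (x : Icc (0 : ℝ) T →₀ ℝ) : 0 ≤ stepForm H T x x :=
  cov_nonneg H H.2.1 H.2.2 x.support x (fun s => s)

theorem stepForm_add (x y z : Icc (0 : ℝ) T →₀ ℝ) :
    stepForm H T (x + y) z = stepForm H T x z + stepForm H T y z := by
  unfold stepForm
  refine Finsupp.sum_add_index' (fun s => ?_) (fun s a b => ?_)
  · simp [Finsupp.sum]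
  · simp only [add_mul]; exact Finsupp.sum_add

theorem stepForm_smul (x y : Icc (0 : ℝ) T →₀ ℝ) (r : ℝ) :
    stepForm H T (r • x) y = r * stepForm H T x y := by
  unfold stepForm
  rw [Finsupp.sum_smul_index (fun s => by simp [Finsupp.sum]), Finsupp.mul_sum]
  refine Finsupp.sum_congr fun s _ => ?_
  rw [Finsupp.mul_sum]
  refine Finsupp.sum_congr fun t _ => ?_
  ring

instance stepCore : PreInnerProductSpace.Core ℝ (Step H T) where
  inner x y := stepForm H T x y
  conj_inner_symm x y := stepForm_comm H T x y
  re_inner_nonneg x := stepForm_nonneg H T x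
  add_left x y z := stepForm_add H T x y z
  smul_left x y r := stepForm_smul H T x y r

instance : SeminormedAddCommGroup (Step H T) :=
  InnerProductSpace.Core.toSeminormedAddCommGroup (𝕜 := ℝ)

instance : InnerProductSpace ℝ (Step H T) := InnerProductSpace.ofCore (stepCore H T)

/-- The canonical Hilbert space `𝔥` of fractional Brownian motion on `[0,T]`: the completion of
the step functions for the inner product `⟨1_[0,s], 1_[0,t]⟩ = R(s,t)`. -/
abbrev CanonicalSpace : Type := UniformSpace.Completion (Step H T)

/-- The step function `1_[0,t]`. -/
def stepInd (t : Icc (0 : ℝ) T) : Step H T := Finsupp.single t (1 : ℝ)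

/-- The indicator function `1_[0,t]` as an element of `𝔥`. -/
def ind (t : Icc (0 : ℝ) T) : CanonicalSpace H T :=
  ((stepInd H T t : Step H T) : UniformSpace.Completion (Step H T))

theorem inner_ind (s t : Icc (0 : ℝ) T) :
    inner ℝ (ind H T s) (ind H T t) = cov H s t := by
  refine (UniformSpace.Completion.inner_coe (𝕜 := ℝ) (stepInd H T s) (stepInd H T t)).trans ?_
  change stepForm H T (Finsupp.single s 1) (Finsupp.single t 1) = _
  simp [stepForm]

/-- The Hilbert space tensor product `𝔥^{⊗2}`. -/
abbrev TensorSquare : Type :=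
  UniformSpace.Completion (CanonicalSpace H T ⊗[ℝ] CanonicalSpace H T)

/-- The function `1_[0,a] ⊗ 1_[0,b]` as an element of `𝔥^{⊗2}`. -/
def ind₂ (a b : Icc (0 : ℝ) T) : TensorSquare H T :=
  ((ind H T a ⊗ₜ[ℝ] ind H T b : CanonicalSpace H T ⊗[ℝ] CanonicalSpace H T))

/-- `h ∈ 𝔥^{⊗2}` is the element given by the function `f` on `[0,T]²`: its inner products with
the (total) family `1_[0,a] ⊗ 1_[0,b]` are those of `f`, where
`⟨φ, 1_[0,a]⟩ = ∫_[0,T] φ(u) ∂R/∂u(u,a) du` in each variable. -/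
def IsElement (f : ℝ → ℝ → ℝ) (h : TensorSquare H T) : Prop :=
  ∀ a b : Icc (0 : ℝ) T,
    IntegrableOn (fun p : ℝ × ℝ => f p.1 p.2 * deriv (fun u => cov H u a) p.1 *
      deriv (fun v => cov H v b) p.2) (Icc 0 T ×ˢ Icc 0 T) ∧
    inner ℝ h (ind₂ H T a b) =
      ∫ p in Icc (0 : ℝ) T ×ˢ Icc (0 : ℝ) T, f p.1 p.2 * deriv (fun u => cov H u a) p.1 *
        deriv (fun v => cov H v b) p.2

/-- `f_T(t,s) = e^{-|t-s|} 1_{0 ≤ s,t ≤ T}`. -/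
def fT (T : ℝ) (t s : ℝ) : ℝ :=
  (Icc 0 T ×ˢ Icc 0 T).indicator (fun p : ℝ × ℝ => Real.exp (-|p.1 - p.2|)) (t, s)

/-- `σ_H² = (4H-1)(1 - 1/cos(2Hπ))`, with its limiting value `2/π` at `H = 1/4`. -/
def sigmaHSq (H : ℝ) : ℝ :=
  if H = 1 / 4 then 2 / Real.pi else (4 * H - 1) * (1 - 1 / Real.cos (2 * H * Real.pi))

/-- `σ² = H² Γ(2H)² σ_H²`. -/
def sigmaSq (H : ℝ) : ℝ := H ^ 2 * Real.Gamma (2 * H) ^ 2 * sigmaHSq H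

end FBM

end

noncomputable section

namespace FBM

open Real Filter Topology

/-!
On `[0,T]²` the function `e^{-|u-v|}` equals `2 ∫_0^T k_r(u) k_r(v) dr + k_T(u) k_T(v)` with
`k_r(u) = e^{-(r-u)} 1_{u ≤ r}`. Hence `f_T` is the element `2 ∫_0^T X_r ⊗ X_r dr + X_T ⊗ X_T` of
the tensor square, where `X_r` is the element `k_r` of the canonical space, and `‖f_T‖²` is a double
integral of `⟨X_r, X_q⟩²`. The Gram kernel `⟨X_r, X_q⟩` is the covariance of `Z_r - e^{-r} Z_0`,
where `Z` is the stationary fractional Ornstein-Uhlenbeck process. If `ρ` is the covariance function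
of `Z` and `G(r) = ∫_0^r ρ²`, this gives `‖f_T‖² = 8 ∫_0^T G + O(G(T) + 1)`.

The spectral density of `Z` is proportional to `λ^{1-2H} / (1 + λ²)`, so that Plancherel's theorem
and a Beta integral evaluate `4 ∫_0^∞ ρ² = σ²`. The convergence rate comes from the decay
`ρ(x) = O(x^{2H-2})`, which is read off the representation of `ρ` as an exponential average of
second differences of `|·|^{2H}`. For `H > 3/4` the same bound gives `G(T) = O(T^{4H-3})` instead,
and for small `T` the estimate follows from `‖X_r‖ = O(T^H)`.
-/

/-! ### Beta-type integrals on the half-line -/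

section BetaIntegral

variable {a k : ℝ}

theorem integral_rpow_mul_exp_neg_mul_one_add_sq (hk : 0 < k) (a x : ℝ) :
    ∫ t in Ioi (0 : ℝ), x ^ a * (t ^ (k - 1) * exp (-(t * (1 + x ^ 2)))) =
      Gamma k * (x ^ a * (1 + x ^ 2) ^ (-k)) := by
  have hx : 0 < 1 + x ^ 2 := by positivity
  simp only [mul_comm _ (1 + x ^ 2)]
  rw [integral_const_mul, integral_rpow_mul_exp_neg_mul_Ioi hk hx, one_div, inv_rpow hx.le,
    rpow_neg hx.le]
  ring

theorem integral_rpow_mul_exp_neg_mul_one_add_sq' (ha : -1 < a) (k : ℝ) {t : ℝ} (ht : 0 < t) :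
    ∫ x in Ioi (0 : ℝ), x ^ a * (t ^ (k - 1) * exp (-(t * (1 + x ^ 2)))) =
      1 / 2 * Gamma ((a + 1) / 2) * (exp (-t) * t ^ (k - (a + 1) / 2 - 1)) := by
  calc ∫ x in Ioi (0 : ℝ), x ^ a * (t ^ (k - 1) * exp (-(t * (1 + x ^ 2))))
    _ = ∫ x in Ioi (0 : ℝ), t ^ (k - 1) * exp (-t) * (x ^ a * exp (-t * x ^ (2 : ℝ))) := by
      refine setIntegral_congr_fun measurableSet_Ioi fun x _ => ?_
      rw [show -(t * (1 + x ^ 2)) = -t + -t * x ^ (2 : ℝ) by rw [rpow_two]; ring, exp_add]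
      ring
    _ = _ := by
      rw [integral_const_mul, integral_rpow_mul_exp_neg_mul_rpow two_pos ha ht,
        show k - (a + 1) / 2 - 1 = k - 1 + -(a + 1) / 2 by ring, rpow_add ht]
      ring

theorem integrable_rpow_mul_exp_neg_mul_one_add_sq (ha : -1 < a) (hk : a + 1 < 2 * k) :
    Integrable (fun p : ℝ × ℝ => p.1 ^ a * (p.2 ^ (k - 1) * exp (-(p.2 * (1 + p.1 ^ 2)))))
      ((volume.restrict (Ioi (0 : ℝ))).prod (volume.restrict (Ioi (0 : ℝ)))) := by
  rw [integrable_prod_iff' (by fun_prop : Measurable _).aestronglyMeasurable]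
  constructor
  · refine ae_restrict_of_forall_mem measurableSet_Ioi fun t ht => ?_
    have h := (integrableOn_rpow_mul_exp_neg_mul_sq ht ha).const_mul (t ^ (k - 1) * exp (-t))
    refine h.congr (Eventually.of_forall fun x => ?_)
    simp only
    rw [show -(t * (1 + x ^ 2)) = -t + -t * x ^ 2 by ring, exp_add]
    ring
  · have hΓ : IntegrableOn (fun t : ℝ => 1 / 2 * Gamma ((a + 1) / 2) *
        (exp (-t) * t ^ (k - (a + 1) / 2 - 1))) (Ioi 0) :=
      (GammaIntegral_convergent (by linarith)).const_mul _
    refine hΓ.congr_fun (fun t ht => ?_) measurableSet_Ioi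
    simp only [← integral_rpow_mul_exp_neg_mul_one_add_sq' ha k ht]
    refine setIntegral_congr_fun measurableSet_Ioi fun x hx => (norm_of_nonneg ?_).symm
    have hx0 : (0 : ℝ) < x := hx
    have ht0 : (0 : ℝ) < t := ht
    positivity

theorem integrableOn_rpow_mul_one_add_sq_rpow (ha : -1 < a) (hk : a + 1 < 2 * k) :
    IntegrableOn (fun x : ℝ => x ^ a * (1 + x ^ 2) ^ (-k)) (Ioi 0) := by
  have hk0 : 0 < k := by linarith
  have h := (integrable_rpow_mul_exp_neg_mul_one_add_sq ha hk).integral_prod_left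
  simp only [integral_rpow_mul_exp_neg_mul_one_add_sq hk0] at h
  rw [IntegrableOn]
  simpa only [inv_mul_cancel_left₀ (Gamma_pos_of_pos hk0).ne'] using h.const_mul (Gamma k)⁻¹

theorem integral_rpow_mul_one_add_sq_rpow (ha : -1 < a) (hk : a + 1 < 2 * k) :
    ∫ x in Ioi (0 : ℝ), x ^ a * (1 + x ^ 2) ^ (-k) =
      Gamma ((a + 1) / 2) * Gamma (k - (a + 1) / 2) / (2 * Gamma k) := by
  have hk0 : 0 < k := by linarith
  have h := integral_integral_swap (f := fun x t : ℝ =>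
    x ^ a * (t ^ (k - 1) * exp (-(t * (1 + x ^ 2)))))
    (integrable_rpow_mul_exp_neg_mul_one_add_sq ha hk)
  rw [setIntegral_congr_fun measurableSet_Ioi
    (fun t ht => integral_rpow_mul_exp_neg_mul_one_add_sq' ha k ht)] at h
  simp only [integral_rpow_mul_exp_neg_mul_one_add_sq hk0] at h
  rw [integral_const_mul, integral_const_mul, ← Gamma_eq_integral (by linarith)] at h
  rw [eq_div_iff (by positivity)]
  linarith

end BetaIntegral

/-! ### The spectral density -/

/-- The weight `λ^{1-2H} / (1 + λ²)` on `λ > 0`: up to the factor `specConst H`, the spectral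
density of the stationary fractional Ornstein-Uhlenbeck process. -/
def specWeight (H l : ℝ) : ℝ := l ^ (1 - 2 * H) / (1 + l ^ 2)

/-- The constant `c_H = Γ(2H+1) sin(πH) / π` for which
`|t|^{2H} = 2 c_H ∫_0^∞ (1 - cos (tλ)) λ^{-1-2H} dλ`. -/
def specConst (H : ℝ) : ℝ := Gamma (2 * H + 1) * sin (π * H) / π

theorem specWeight_nonneg (H : ℝ) {l : ℝ} (hl : 0 ≤ l) : 0 ≤ specWeight H l :=
  div_nonneg (rpow_nonneg hl _) (by positivity)

@[fun_prop]
theorem measurable_specWeight (H : ℝ) : Measurable (specWeight H) := by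
  unfold specWeight; fun_prop

theorem specWeight_eq_sq_div_mul_rpow (H : ℝ) {l : ℝ} (hl : 0 < l) :
    specWeight H l = l ^ 2 / (1 + l ^ 2) * l ^ (-1 - 2 * H) := by
  rw [specWeight, show (1 : ℝ) - 2 * H = 2 + (-1 - 2 * H) by ring, rpow_add hl, rpow_two]
  ring

theorem specWeight_eq_rpow_mul (H l : ℝ) :
    specWeight H l = l ^ (1 - 2 * H) * (1 + l ^ 2) ^ (-1 : ℝ) := by
  rw [specWeight, rpow_neg_one, div_eq_mul_inv]

theorem specWeight_sq (H : ℝ) {l : ℝ} (hl : 0 < l) :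
    specWeight H l ^ 2 = l ^ (2 - 4 * H) * (1 + l ^ 2) ^ (-(2 : ℝ)) := by
  rw [specWeight, div_pow, ← rpow_mul_natCast hl.le, rpow_neg (by positivity), rpow_two,
    div_eq_mul_inv]
  congr 2; push_cast; ring

theorem integrableOn_specWeight {H : ℝ} (h0 : 0 < H) (h1 : H < 1) :
    IntegrableOn (specWeight H) (Ioi 0) := by
  simp only [funext (specWeight_eq_rpow_mul H)]
  exact integrableOn_rpow_mul_one_add_sq_rpow (by linarith) (by linarith)

theorem integral_specWeight {H : ℝ} (h0 : 0 < H) (h1 : H < 1) :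
    ∫ l in Ioi (0 : ℝ), specWeight H l = π / (2 * sin (π * H)) := by
  simp only [specWeight_eq_rpow_mul]
  rw [integral_rpow_mul_one_add_sq_rpow (by linarith) (by linarith),
    show (1 - 2 * H + 1) / 2 = 1 - H by ring, show (1 : ℝ) - (1 - H) = H by ring, mul_comm,
    Gamma_mul_Gamma_one_sub, Gamma_one]
  field_simp

theorem integrableOn_specWeight_sq {H : ℝ} (h0 : 0 < H) (h1 : H < 3 / 4) :
    IntegrableOn (fun l => specWeight H l ^ 2) (Ioi 0) :=
  (integrableOn_rpow_mul_one_add_sq_rpow (by linarith) (by linarith)).congr_fun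
    (fun _ hl => (specWeight_sq H hl).symm) measurableSet_Ioi

theorem integral_specWeight_sq {H : ℝ} (h0 : 0 < H) (h1 : H < 3 / 4) :
    ∫ l in Ioi (0 : ℝ), specWeight H l ^ 2 = Gamma (3 / 2 - 2 * H) * Gamma (1 / 2 + 2 * H) / 2 := by
  rw [setIntegral_congr_fun measurableSet_Ioi (fun l hl => specWeight_sq H hl),
    integral_rpow_mul_one_add_sq_rpow (by linarith) (by linarith), Gamma_two]
  ring_nf

theorem sin_pi_mul_pos {H : ℝ} (h0 : 0 < H) (h1 : H < 1) : 0 < sin (π * H) :=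
  sin_pos_of_pos_of_lt_pi (by positivity) (by nlinarith [pi_pos])

theorem specConst_pos {H : ℝ} (h0 : 0 < H) (h1 : H < 1) : 0 < specConst H :=
  div_pos (mul_pos (Gamma_pos_of_pos (by linarith)) (sin_pi_mul_pos h0 h1)) pi_pos

theorem Gamma_mul_Gamma_eq_div_cos {H : ℝ} (hH : H ≠ 1 / 4) (hcos : cos (2 * H * π) ≠ 0) :
    Gamma (3 / 2 - 2 * H) * Gamma (1 / 2 + 2 * H) =
      -((4 * H - 1) / 2 * π / cos (2 * H * π)) := by
  have hne : 2 * H - 1 / 2 ≠ 0 := fun h => hH (by linarith)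
  have hrec : Gamma (1 / 2 + 2 * H) = (2 * H - 1 / 2) * Gamma (2 * H - 1 / 2) := by
    rw [← Gamma_add_one hne]; ring_nf
  have hrefl := Gamma_mul_Gamma_one_sub (2 * H - 1 / 2)
  rw [show (1 : ℝ) - (2 * H - 1 / 2) = 3 / 2 - 2 * H by ring,
    show π * (2 * H - 1 / 2) = -(π / 2 - 2 * H * π) by ring, sin_neg, sin_pi_div_two_sub] at hrefl
  calc Gamma (3 / 2 - 2 * H) * Gamma (1 / 2 + 2 * H)
    _ = (2 * H - 1 / 2) * (Gamma (2 * H - 1 / 2) * Gamma (3 / 2 - 2 * H)) := by rw [hrec]; ring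
    _ = _ := by rw [hrefl]; field_simp; ring

theorem cos_two_mul_mul_pi_ne_zero {H : ℝ} (h0 : 0 < H) (h1 : H < 3 / 4) (hH : H ≠ 1 / 4) :
    cos (2 * H * π) ≠ 0 := by
  have hpi := pi_pos
  rcases lt_or_gt_of_ne hH with h | h
  · exact (cos_pos_of_mem_Ioo ⟨by nlinarith, by nlinarith⟩).ne'
  · exact (cos_neg_of_pi_div_two_lt_of_lt (by nlinarith) (by nlinarith)).ne

theorem sin_pi_mul_sq_mul_Gamma_mul_Gamma {H : ℝ} (h0 : 0 < H) (h1 : H < 3 / 4) :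
    4 * sin (π * H) ^ 2 * (Gamma (3 / 2 - 2 * H) * Gamma (1 / 2 + 2 * H)) = π * sigmaHSq H := by
  have hsin : sin (π * H) ^ 2 = (1 - cos (2 * H * π)) / 2 := by
    rw [show 2 * H * π = 2 * (π * H) by ring, cos_two_mul, cos_sq']; ring
  rw [hsin, sigmaHSq]
  split_ifs with hH
  · subst hH
    norm_num [show 1 / 2 * π = π / 2 by ring]
    field_simp
  · have hcos := cos_two_mul_mul_pi_ne_zero h0 h1 hH
    rw [Gamma_mul_Gamma_eq_div_cos hH hcos]
    field_simp
    ring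

theorem specConst_sq_mul_integral_specWeight_sq {H : ℝ} (h0 : 0 < H) (h1 : H < 3 / 4) :
    2 * π * specConst H ^ 2 * ∫ l in Ioi (0 : ℝ), specWeight H l ^ 2 = sigmaSq H := by
  have hσ := sin_pi_mul_sq_mul_Gamma_mul_Gamma h0 h1
  rw [integral_specWeight_sq h0 h1, specConst, Gamma_add_one (by linarith), sigmaSq]
  calc _ = H ^ 2 * Gamma (2 * H) ^ 2 / π *
        (4 * sin (π * H) ^ 2 * (Gamma (3 / 2 - 2 * H) * Gamma (1 / 2 + 2 * H))) := by
        field_simp; ring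
    _ = _ := by rw [hσ]; field_simp

/-! ### The stationary covariance -/

/-- The covariance function of the stationary fractional Ornstein-Uhlenbeck process, in its
spectral form. -/
def ouCov (H x : ℝ) : ℝ :=
  specConst H * ∫ l in Ioi (0 : ℝ), cos (x * l) * specWeight H l

theorem ouCov_neg (H x : ℝ) : ouCov H (-x) = ouCov H x := by
  simp only [ouCov, neg_mul, cos_neg]

theorem norm_cos_mul_specWeight_le (H x : ℝ) {l : ℝ} (hl : 0 < l) :
    ‖cos (x * l) * specWeight H l‖ ≤ specWeight H l := by
  rw [norm_mul, norm_of_nonneg (specWeight_nonneg H hl.le)]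
  exact mul_le_of_le_one_left (specWeight_nonneg H hl.le) (abs_cos_le_one _)

theorem integrableOn_cos_mul_specWeight {H : ℝ} (h0 : 0 < H) (h1 : H < 1) (x : ℝ) :
    IntegrableOn (fun l => cos (x * l) * specWeight H l) (Ioi 0) :=
  (integrableOn_specWeight h0 h1).mono' (by fun_prop : Measurable _).aestronglyMeasurable
    (ae_restrict_of_forall_mem measurableSet_Ioi fun _ hl => norm_cos_mul_specWeight_le H x hl)

theorem continuous_ouCov {H : ℝ} (h0 : 0 < H) (h1 : H < 1) : Continuous (ouCov H) := by
  refine continuous_const.mul (continuous_of_dominated (bound := specWeight H)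
    (fun x => (integrableOn_cos_mul_specWeight h0 h1 x).aestronglyMeasurable)
    (fun x => ae_restrict_of_forall_mem measurableSet_Ioi
      fun l hl => norm_cos_mul_specWeight_le H x hl)
    (integrableOn_specWeight h0 h1) (Eventually.of_forall fun l => by fun_prop))

theorem abs_ouCov_le_ouCov_zero {H : ℝ} (h0 : 0 < H) (h1 : H < 1) (x : ℝ) :
    |ouCov H x| ≤ ouCov H 0 := by
  have hint : |∫ l in Ioi (0 : ℝ), cos (x * l) * specWeight H l| ≤
      ∫ l in Ioi (0 : ℝ), specWeight H l :=
    norm_integral_le_of_norm_le (integrableOn_specWeight h0 h1)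
      (ae_restrict_of_forall_mem measurableSet_Ioi fun _ hl => norm_cos_mul_specWeight_le H x hl)
  rw [ouCov, ouCov, abs_mul, abs_of_pos (specConst_pos h0 h1)]
  simpa only [zero_mul, cos_zero, one_mul] using
    mul_le_mul_of_nonneg_left hint (specConst_pos h0 h1).le

/-! ### The stationary covariance as an average of second differences -/

theorem integrableOn_exp_neg_mul_cos (l : ℝ) :
    IntegrableOn (fun y : ℝ => exp (-y) * cos (l * y)) (Ioi 0) :=
  (integrableOn_exp_neg_Ioi 0).mul_bdd (c := 1)
    (by fun_prop : Measurable fun y => cos (l * y)).aestronglyMeasurable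
    (Eventually.of_forall fun _ => abs_cos_le_one _)

theorem integral_exp_neg_mul_cos (l : ℝ) :
    ∫ y in Ioi (0 : ℝ), exp (-y) * cos (l * y) = 1 / (1 + l ^ 2) := by
  have hre : (-1 + l * Complex.I).re < 0 := by simp
  have hexp : ∀ y : ℝ,
      exp (-y) * cos (l * y) = RCLike.re (Complex.exp ((-1 + l * Complex.I) * y)) := by
    intro y
    simp [Complex.exp_re]
  simp only [hexp]
  rw [integral_re (integrableOn_exp_mul_complex_Ioi hre 0), integral_exp_mul_complex_Ioi hre]
  simp [Complex.div_re, Complex.normSq_apply, sq]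

theorem integrableOn_exp_neg_mul_one_sub_cos (l : ℝ) :
    IntegrableOn (fun y : ℝ => exp (-y) * (1 - cos (l * y))) (Ioi 0) := by
  simp only [mul_sub, mul_one]
  exact (integrableOn_exp_neg_Ioi 0).sub (integrableOn_exp_neg_mul_cos l)

theorem integral_exp_neg_mul_one_sub_cos (l : ℝ) :
    ∫ y in Ioi (0 : ℝ), exp (-y) * (1 - cos (l * y)) = l ^ 2 / (1 + l ^ 2) := by
  simp only [mul_sub, mul_one]
  rw [integral_sub (integrableOn_exp_neg_Ioi 0) (integrableOn_exp_neg_mul_cos l),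
    integral_exp_neg_mul_cos, integral_exp_neg_Ioi_zero]
  have : 1 + l ^ 2 ≠ 0 := by positivity
  field_simp
  ring

theorem integrable_exp_neg_mul_one_sub_cos_mul_rpow {H : ℝ} (h0 : 0 < H) (h1 : H < 1) :
    Integrable (fun p : ℝ × ℝ => exp (-p.2) * (1 - cos (p.1 * p.2)) * p.1 ^ (-1 - 2 * H))
      ((volume.restrict (Ioi (0 : ℝ))).prod (volume.restrict (Ioi (0 : ℝ)))) := by
  rw [integrable_prod_iff (by fun_prop : Measurable _).aestronglyMeasurable]
  constructor
  · exact Eventually.of_forall fun l =>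
      (integrableOn_exp_neg_mul_one_sub_cos l).mul_const (l ^ (-1 - 2 * H))
  · refine (integrableOn_specWeight h0 h1).congr_fun (fun l hl => ?_) measurableSet_Ioi
    rw [specWeight_eq_sq_div_mul_rpow H hl, ← integral_exp_neg_mul_one_sub_cos,
      ← integral_mul_const]
    refine setIntegral_congr_fun measurableSet_Ioi fun y _ => (norm_of_nonneg ?_).symm
    have hcos : 0 ≤ 1 - cos (l * y) := sub_nonneg.2 (cos_le_one _)
    have hl0 : (0 : ℝ) < l := hl
    positivity

/-- The symmetric second difference of `|·|^{2H}` at `x` with step `y`. -/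
def secondDiff (H x y : ℝ) : ℝ := |x + y| ^ (2 * H) + |x - y| ^ (2 * H) - 2 * |x| ^ (2 * H)

theorem integral_one_sub_cos_mul_secondDiff {H : ℝ} (h0 : 0 < H) (h1 : H < 1) (x y : ℝ) :
    (∫ l in Ioi (0 : ℝ), (1 - cos l) * l ^ (-1 - 2 * H)) * secondDiff H x y =
      ∫ l in Ioi (0 : ℝ), 2 * cos (x * l) * ((1 - cos (l * y)) * l ^ (-1 - 2 * H)) := by
  have hint := fun r => integrableOn_one_sub_cos H h0 h1 r
  have htrig : ∀ l : ℝ, 2 * cos (x * l) * ((1 - cos (l * y)) * l ^ (-1 - 2 * H)) =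
      ((1 - cos ((x + y) * l)) * l ^ (-1 - 2 * H) + (1 - cos ((x - y) * l)) * l ^ (-1 - 2 * H)) -
        2 * ((1 - cos (x * l)) * l ^ (-1 - 2 * H)) := by
    intro l
    rw [add_mul x, sub_mul x, cos_add, cos_sub, mul_comm l y]; ring
  have hadd : IntegrableOn (fun l => (1 - cos ((x + y) * l)) * l ^ (-1 - 2 * H) +
      (1 - cos ((x - y) * l)) * l ^ (-1 - 2 * H)) (Ioi 0) := (hint (x + y)).add (hint (x - y))
  simp only [htrig]
  rw [integral_sub hadd ((hint x).const_mul 2), integral_add (hint _) (hint _), integral_const_mul,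
    integral_one_sub_cos H h0, integral_one_sub_cos H h0, integral_one_sub_cos H h0, secondDiff]
  ring

theorem integral_one_sub_cos_mul_integral_secondDiff {H : ℝ} (h0 : 0 < H) (h1 : H < 1) (x : ℝ) :
    (∫ l in Ioi (0 : ℝ), (1 - cos l) * l ^ (-1 - 2 * H)) *
      ∫ y in Ioi (0 : ℝ), exp (-y) * secondDiff H x y =
      2 * ∫ l in Ioi (0 : ℝ), cos (x * l) * specWeight H l := by
  have hint : Integrable (Function.uncurry fun l y : ℝ => 2 * cos (x * l) *
      (exp (-y) * (1 - cos (l * y)) * l ^ (-1 - 2 * H)))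
      ((volume.restrict (Ioi (0 : ℝ))).prod (volume.restrict (Ioi (0 : ℝ)))) := by
    refine (integrable_exp_neg_mul_one_sub_cos_mul_rpow h0 h1).bdd_mul (c := 2)
      (by fun_prop : Measurable fun p : ℝ × ℝ => 2 * cos (x * p.1)).aestronglyMeasurable
      (Eventually.of_forall fun p => ?_)
    rw [norm_mul, Real.norm_two, norm_eq_abs]
    linarith [abs_cos_le_one (x * p.1)]
  calc _ = ∫ y in Ioi (0 : ℝ), ∫ l in Ioi (0 : ℝ),
        2 * cos (x * l) * (exp (-y) * (1 - cos (l * y)) * l ^ (-1 - 2 * H)) := by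
        rw [← integral_const_mul]
        refine setIntegral_congr_fun measurableSet_Ioi fun y _ => ?_
        simp only [mul_left_comm _ (exp (-y)), mul_assoc (exp (-y))]
        rw [integral_one_sub_cos_mul_secondDiff h0 h1, ← integral_const_mul]
    _ = ∫ l in Ioi (0 : ℝ), ∫ y in Ioi (0 : ℝ),
        2 * cos (x * l) * (exp (-y) * (1 - cos (l * y)) * l ^ (-1 - 2 * H)) :=
        (integral_integral_swap hint).symm
    _ = _ := by
        rw [← integral_const_mul]
        refine setIntegral_congr_fun measurableSet_Ioi fun l hl => ?_
        rw [integral_const_mul, integral_mul_const, integral_exp_neg_mul_one_sub_cos,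
          specWeight_eq_sq_div_mul_rpow H hl]
        ring

theorem integral_exp_neg_mul_secondDiff_zero {H : ℝ} (h0 : 0 < H) :
    ∫ y in Ioi (0 : ℝ), exp (-y) * secondDiff H 0 y = 2 * Gamma (2 * H + 1) := by
  rw [Gamma_eq_integral (by linarith), ← integral_const_mul]
  refine setIntegral_congr_fun measurableSet_Ioi fun y hy => ?_
  simp only [secondDiff, zero_add, zero_sub, abs_neg, abs_zero, abs_of_pos (mem_Ioi.1 hy),
    zero_rpow (by linarith : 2 * H ≠ 0), add_sub_cancel_right]
  ring

theorem two_mul_specConst_mul_integral_one_sub_cos {H : ℝ} (h0 : 0 < H) (h1 : H < 1) :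
    2 * specConst H * ∫ l in Ioi (0 : ℝ), (1 - cos l) * l ^ (-1 - 2 * H) = 1 := by
  have h := integral_one_sub_cos_mul_integral_secondDiff h0 h1 0
  simp only [zero_mul, cos_zero, one_mul] at h
  rw [integral_exp_neg_mul_secondDiff_zero h0, integral_specWeight h0 h1] at h
  have hsin := sin_pi_mul_pos h0 h1
  rw [specConst]
  generalize sin (π * H) = S at h hsin ⊢
  field_simp at h ⊢
  linarith

theorem ouCov_eq_integral_secondDiff {H : ℝ} (h0 : 0 < H) (h1 : H < 1) (x : ℝ) :
    ouCov H x = 1 / 4 * ∫ y in Ioi (0 : ℝ), exp (-y) * secondDiff H x y := by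
  have h := integral_one_sub_cos_mul_integral_secondDiff h0 h1 x
  have hc := two_mul_specConst_mul_integral_one_sub_cos h0 h1
  rw [ouCov]
  linear_combination (-specConst H / 2) * h +
    ((∫ y in Ioi (0 : ℝ), exp (-y) * secondDiff H x y) / 4) * hc

/-! ### Decay of the stationary covariance -/

theorem abs_mul_rpow_two_mul {x : ℝ} (hx : 0 < x) (H w : ℝ) :
    |x * w| ^ (2 * H) = x ^ (2 * H) * (w ^ 2) ^ H := by
  rw [abs_mul, abs_of_pos hx, mul_rpow hx.le (abs_nonneg _), ← sq_abs w,
    ← rpow_natCast_mul (abs_nonneg _), Nat.cast_ofNat]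

theorem secondDiff_mul {x : ℝ} (hx : 0 < x) (H z : ℝ) :
    secondDiff H x (x * z) = x ^ (2 * H) * (((1 + z) ^ 2) ^ H + ((1 - z) ^ 2) ^ H - 2) := by
  rw [secondDiff, show x + x * z = x * (1 + z) by ring, show x - x * z = x * (1 - z) by ring,
    abs_mul_rpow_two_mul hx, abs_mul_rpow_two_mul hx, abs_of_pos hx]
  ring

theorem sq_rpow_add_sq_rpow_le {H : ℝ} (h0 : 0 ≤ H) (h1 : H ≤ 1) (z : ℝ) :
    ((1 + z) ^ 2) ^ H + ((1 - z) ^ 2) ^ H ≤ 2 + 2 * z ^ 2 := by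
  have bernoulli : ∀ w : ℝ, 0 ≤ w → w ^ H ≤ 1 + H * (w - 1) := fun w hw => by
    simpa only [add_sub_cancel] using
      rpow_one_add_le_one_add_mul_self (s := w - 1) (by linarith) h0 h1
  have hadd := bernoulli _ (sq_nonneg (1 + z))
  have hsub := bernoulli _ (sq_nonneg (1 - z))
  nlinarith [sq_nonneg z]

theorem le_sq_rpow_add_sq_rpow {H : ℝ} (h1 : H ≤ 1) (z : ℝ) :
    2 - 2 * z ^ 2 ≤ ((1 + z) ^ 2) ^ H + ((1 - z) ^ 2) ^ H := by
  have hA := rpow_nonneg (sq_nonneg (1 + z)) H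
  have hB := rpow_nonneg (sq_nonneg (1 - z)) H
  rcases le_or_gt 1 (z ^ 2) with hz | hz
  · linarith
  -- The arithmetic mean dominates the geometric one, and the product of the two terms is explicit.
  have hprod : (1 - z ^ 2) ^ 2 ≤ ((1 + z) ^ 2) ^ H * ((1 - z) ^ 2) ^ H := by
    rw [← mul_rpow (sq_nonneg _) (sq_nonneg _),
      show (1 + z) ^ 2 * (1 - z) ^ 2 = (1 - z ^ 2) ^ 2 by ring]
    exact self_le_rpow_of_le_one (sq_nonneg _) (by nlinarith [sq_nonneg z]) h1
  refine (abs_le_of_sq_le_sq' ?_ (by linarith)).2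
  nlinarith [sq_nonneg (((1 + z) ^ 2) ^ H - ((1 - z) ^ 2) ^ H)]

theorem abs_secondDiff_le {H : ℝ} (h0 : 0 ≤ H) (h1 : H ≤ 1) {x : ℝ} (hx : 0 < x) (y : ℝ) :
    |secondDiff H x y| ≤ 2 * x ^ (2 * H - 2) * y ^ 2 := by
  obtain ⟨z, rfl⟩ : ∃ z, y = x * z := ⟨y / x, by field_simp⟩
  have hz : |((1 + z) ^ 2) ^ H + ((1 - z) ^ 2) ^ H - 2| ≤ 2 * z ^ 2 :=
    abs_le.2 ⟨by linarith [le_sq_rpow_add_sq_rpow h1 z],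
      by linarith [sq_rpow_add_sq_rpow_le h0 h1 z]⟩
  rw [secondDiff_mul hx, abs_mul, abs_of_pos (rpow_pos_of_pos hx _)]
  calc _ ≤ x ^ (2 * H) * (2 * z ^ 2) := mul_le_mul_of_nonneg_left hz (rpow_nonneg hx.le _)
    _ = _ := by rw [rpow_sub hx, rpow_two]; field_simp

theorem abs_secondDiff_half_le {x y : ℝ} (hx : 0 < x) (hy : 0 < y) :
    |secondDiff (1 / 2) x y| ≤ 2 * x ^ (-(2 : ℝ)) * y ^ 3 := by
  rw [rpow_neg hx.le, rpow_two]
  simp only [secondDiff, show (2 : ℝ) * (1 / 2) = 1 by norm_num, rpow_one]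
  rw [abs_of_pos (by linarith : 0 < x + y), abs_of_pos hx]
  rcases le_or_gt y x with hyx | hyx
  · rw [abs_of_nonneg (by linarith : 0 ≤ x - y), show x + y + (x - y) - 2 * x = 0 by ring, abs_zero]
    positivity
  · rw [abs_of_neg (by linarith : x - y < 0), show x + y + -(x - y) - 2 * x = 2 * (y - x) by ring,
      abs_of_pos (by linarith), show 2 * (x ^ 2)⁻¹ * y ^ 3 = 2 * y ^ 3 / x ^ 2 by ring,
      le_div_iff₀ (by positivity)]
    nlinarith [mul_pos hy (pow_pos hx 2), pow_pos hx 3, mul_self_lt_mul_self hx.le hyx,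
      mul_pos hy hy]

theorem abs_ouCov_le_of_abs_secondDiff_le {H : ℝ} (h0 : 0 < H) (h1 : H < 1) {x c : ℝ} {n : ℕ}
    (h : ∀ y > 0, |secondDiff H x y| ≤ c * y ^ n) : |ouCov H x| ≤ c * n.factorial / 4 := by
  have hpos : (0 : ℝ) < n + 1 := by positivity
  have hΓ := GammaIntegral_convergent hpos
  have hval := Gamma_eq_integral hpos
  simp only [add_sub_cancel_right, rpow_natCast] at hΓ hval
  have hle : ‖∫ y in Ioi (0 : ℝ), exp (-y) * secondDiff H x y‖ ≤
      ∫ y in Ioi (0 : ℝ), c * (exp (-y) * y ^ n) := by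
    refine norm_integral_le_of_norm_le (hΓ.const_mul c)
      (ae_restrict_of_forall_mem measurableSet_Ioi fun y hy => ?_)
    rw [norm_mul, norm_of_nonneg (exp_pos _).le, mul_left_comm]
    exact mul_le_mul_of_nonneg_left (h y hy) (exp_pos _).le
  rw [integral_const_mul, ← hval, Gamma_nat_eq_factorial, norm_eq_abs] at hle
  rw [ouCov_eq_integral_secondDiff h0 h1, abs_mul, abs_of_pos (by norm_num : (0 : ℝ) < 1 / 4)]
  linarith

theorem abs_ouCov_le {H : ℝ} (h0 : 0 < H) (h1 : H < 1) {x : ℝ} (hx : 0 < x) :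
    |ouCov H x| ≤ x ^ (2 * H - 2) := by
  have h := abs_ouCov_le_of_abs_secondDiff_le h0 h1 fun y _ => abs_secondDiff_le h0.le h1.le hx y
  norm_num at h
  linarith

theorem abs_ouCov_half_le {x : ℝ} (hx : 0 < x) : |ouCov (1 / 2) x| ≤ 3 * x ^ (-(2 : ℝ)) := by
  have h := abs_ouCov_le_of_abs_secondDiff_le one_half_pos one_half_lt_one fun y hy =>
    abs_secondDiff_half_le hx hy
  norm_num [Nat.factorial] at h ⊢
  linarith

/-! ### Plancherel's theorem and the square integral of the stationary covariance -/

open scoped FourierTransform in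
theorem fourier_toLp_ae_eq {f : ℝ → ℂ} (hf : Integrable f) (hf2 : MemLp f 2) :
    ((𝓕 (hf2.toLp f) : Lp ℂ 2 (volume : Measure ℝ)) : ℝ → ℂ) =ᵐ[volume] 𝓕 f := by
  set g : Lp ℂ 2 (volume : Measure ℝ) := 𝓕 (hf2.toLp f) with hg
  have hcont : Continuous (𝓕 f : ℝ → ℂ) :=
    VectorFourier.fourierIntegral_continuous continuous_fourierChar (innerSL ℝ).continuous₂ hf
  refine ae_eq_of_integral_contDiff_smul_eq ((Lp.memLp g).locallyIntegrable (by norm_num))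
    hcont.locallyIntegrable fun φ hφ hφc => ?_
  -- As tempered distributions, both sides are tested against the Schwartz function `φ`.
  have hψc : HasCompactSupport (fun x => (φ x : ℂ)) := hφc.comp_left Complex.ofReal_zero
  set ψ : SchwartzMap ℝ ℂ := hψc.toSchwartzMap (Complex.ofRealCLM.contDiff.comp hφ)
  have hψx : ∀ x, ψ x = (φ x : ℂ) := fun x => rfl
  have hψg : ∫ x, φ x • g x = Lp.toTemperedDistribution g ψ := by
    rw [Lp.toTemperedDistribution_apply]
    simp only [hψx, Complex.real_smul, smul_eq_mul]
  have hψf : Lp.toTemperedDistribution (hf2.toLp f) (𝓕 ψ) = ∫ x, f x • (𝓕 (ψ : ℝ → ℂ)) x := by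
    rw [Lp.toTemperedDistribution_apply]
    refine integral_congr_ae (hf2.coeFn_toLp.mono fun x hx => ?_)
    simp only [hx, SchwartzMap.fourier_coe, smul_eq_mul, mul_comm]
  have hflip : ∫ x, (𝓕 f) x • ψ x = ∫ x, f x • (𝓕 (ψ : ℝ → ℂ)) x :=
    VectorFourier.integral_fourierIntegral_smul_eq_flip (μ := volume) (ν := volume)
      (L := innerₗ ℝ) continuous_fourierChar (innerSL ℝ).continuous₂ hf
      ψ.integrable |>.trans (by rw [flip_innerₗ]; rfl)
  rw [hψg, hg, ← Lp.fourier_toTemperedDistribution_eq, TemperedDistribution.fourier_apply, hψf,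
    ← hflip]
  simp only [hψx, Complex.real_smul, smul_eq_mul, mul_comm]

theorem integral_norm_sq_eq_norm_sq {α F : Type*} [MeasurableSpace α] {μ : Measure α}
    [NormedAddCommGroup F] [InnerProductSpace ℂ F] (f : Lp F 2 μ) :
    ∫ x, ‖f x‖ ^ 2 ∂μ = ‖f‖ ^ 2 := by
  have h := L2.inner_def (𝕜 := ℂ) f f
  simp only [inner_self_eq_norm_sq_to_K] at h
  refine (Complex.ofReal_injective ?_).symm
  rw [← integral_complex_ofReal]
  push_cast
  exact h

open scoped FourierTransform in
theorem integral_norm_fourier_sq {f : ℝ → ℂ} (hf : Integrable f) (hf2 : MemLp f 2) :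
    ∫ x, ‖(𝓕 f) x‖ ^ 2 = ∫ x, ‖f x‖ ^ 2 :=
  calc ∫ x, ‖(𝓕 f) x‖ ^ 2
      = ∫ x, ‖(𝓕 (hf2.toLp f) : Lp ℂ 2 (volume : Measure ℝ)) x‖ ^ 2 :=
        integral_congr_ae ((fourier_toLp_ae_eq hf hf2).mono fun x hx => by simp only [hx])
    _ = ∫ x, ‖hf2.toLp f x‖ ^ 2 := by
        rw [integral_norm_sq_eq_norm_sq, integral_norm_sq_eq_norm_sq, Lp.norm_fourier_eq]
    _ = ∫ x, ‖f x‖ ^ 2 := integral_congr_ae (hf2.coeFn_toLp.mono fun x hx => by simp only [hx])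

theorem integrable_comp_abs {F : Type*} [NormedAddCommGroup F] {f : ℝ → F}
    (hf : IntegrableOn f (Ioi 0)) : Integrable (fun x => f |x|) := by
  have hpos : IntegrableOn (fun x => f |x|) (Ioi 0) :=
    hf.congr_fun (fun x hx => by simp only [abs_of_pos (mem_Ioi.1 hx)]) measurableSet_Ioi
  have hneg : IntegrableOn (fun x => f |x|) (Iic 0) := by
    have h := (integrableOn_Ici_iff_integrableOn_Ioi (by finiteness) |>.2 hpos).comp_neg
    simpa only [abs_neg, involutiveNeg, Set.neg_Ici, neg_zero] using h
  rw [← integrableOn_univ, ← Iic_union_Ioi (a := (0 : ℝ))]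
  exact hneg.union hpos

open scoped FourierTransform in
theorem fourier_ofReal_comp_abs {f : ℝ → ℝ} (hf : IntegrableOn f (Ioi 0)) (w : ℝ) :
    𝓕 (fun l : ℝ => (f |l| : ℂ)) w =
      ((2 * ∫ l in Ioi (0 : ℝ), cos (2 * π * w * l) * f l : ℝ) : ℂ) := by
  have hcos_int : Integrable (fun l : ℝ => cos (2 * π * w * l) * f |l|) :=
    (integrable_comp_abs hf).bdd_mul (c := 1) (by fun_prop : Measurable _).aestronglyMeasurable
      (Eventually.of_forall fun l => abs_cos_le_one _)
  have hsin_int : Integrable (fun l : ℝ => sin (2 * π * w * l) * f |l|) :=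
    (integrable_comp_abs hf).bdd_mul (c := 1) (by fun_prop : Measurable _).aestronglyMeasurable
      (Eventually.of_forall fun l => abs_sin_le_one _)
  have hsin : ∫ l : ℝ, sin (2 * π * w * l) * f |l| = 0 := by
    have h := integral_neg_eq_self (fun l : ℝ => sin (2 * π * w * l) * f |l|) volume
    simp only [mul_neg, sin_neg, abs_neg, neg_mul, integral_neg] at h
    linarith
  have hcos : ∫ l : ℝ, cos (2 * π * w * l) * f |l| =
      2 * ∫ l in Ioi (0 : ℝ), cos (2 * π * w * l) * f l := by
    rw [← integral_comp_abs (f := fun l => cos (2 * π * w * l) * f l)]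
    congr 1
    ext l
    rcases abs_choice l with h | h <;> simp only [h, mul_neg, cos_neg]
  have hexp : ∀ l : ℝ, Complex.exp (↑(-2 * π * l * w) * Complex.I) • (f |l| : ℂ) =
      ((cos (2 * π * w * l) * f |l| : ℝ) : ℂ) -
      Complex.I * ((sin (2 * π * w * l) * f |l| : ℝ) : ℂ) := by
    intro l
    rw [Complex.exp_mul_I, ← Complex.ofReal_cos, ← Complex.ofReal_sin,
      show -2 * π * l * w = -(2 * π * w * l) by ring, cos_neg, sin_neg, smul_eq_mul]
    push_cast
    ring
  simp only [fourier_real_eq_integral_exp_smul, hexp]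
  rw [integral_sub hcos_int.ofReal (hsin_int.ofReal.const_mul _), integral_const_mul,
    integral_complex_ofReal, integral_complex_ofReal, hsin, hcos, Complex.ofReal_zero, mul_zero,
    sub_zero]

theorem integral_cos_transform_sq {f : ℝ → ℝ} (hf : IntegrableOn f (Ioi 0))
    (hf2 : IntegrableOn (fun l => f l ^ 2) (Ioi 0)) :
    ∫ x in Ioi (0 : ℝ), (∫ l in Ioi (0 : ℝ), cos (x * l) * f l) ^ 2 =
      π / 2 * ∫ l in Ioi (0 : ℝ), f l ^ 2 := by
  set g : ℝ → ℝ := fun x => (∫ l in Ioi (0 : ℝ), cos (x * l) * f l) ^ 2 with hg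
  have hint : Integrable (fun l : ℝ => (f |l| : ℂ)) := (integrable_comp_abs hf).ofReal
  have hL2 : MemLp (fun l : ℝ => (f |l| : ℂ)) 2 := by
    refine (memLp_two_iff_integrable_sq_norm hint.aestronglyMeasurable).2 ?_
    simpa only [Complex.norm_real, norm_eq_abs, sq_abs] using
      integrable_comp_abs (f := fun l => f l ^ 2) hf2
  have heven : ∫ x, g x = 2 * ∫ x in Ioi (0 : ℝ), g x := by
    rw [← integral_comp_abs]
    congr 1
    ext x
    rcases abs_choice x with h | h <;> simp only [h, hg, neg_mul, cos_neg]
  have h := integral_norm_fourier_sq hint hL2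
  simp only [fourier_ofReal_comp_abs hf, Complex.norm_real, norm_eq_abs, sq_abs, mul_pow] at h
  rw [integral_const_mul, Measure.integral_comp_mul_left g (2 * π),
    integral_comp_abs (f := fun l => f l ^ 2), heven, abs_of_pos (by positivity),
    smul_eq_mul] at h
  field_simp at h
  linarith

theorem four_mul_integral_ouCov_sq {H : ℝ} (h0 : 0 < H) (h1 : H < 3 / 4) :
    4 * ∫ x in Ioi (0 : ℝ), ouCov H x ^ 2 = sigmaSq H := by
  simp only [ouCov, mul_pow]
  rw [integral_const_mul, integral_cos_transform_sq (integrableOn_specWeight h0 (by linarith))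
    (integrableOn_specWeight_sq h0 h1), ← specConst_sq_mul_integral_specWeight_sq h0 h1]
  ring

/-! ### The Ornstein-Uhlenbeck filter -/

section Filter

variable {E : Type*} [NormedAddCommGroup E] [NormedSpace ℝ E]

/-- The operator that sends a curve `f` with `f 0 = 0` to `t ↦ ∫_0^t e^{-(t-u)} df(u)`; integration
by parts removes the differential, so that `f` need only be continuous. -/
def ouFilter (f : ℝ → E) (t : ℝ) : E := f t - ∫ u in (0 : ℝ)..t, exp (-(t - u)) • f u

theorem ouFilter_congr {f g : ℝ → E} {t : ℝ} (ht : 0 ≤ t) (h : EqOn f g (Icc 0 t)) :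
    ouFilter f t = ouFilter g t := by
  rw [ouFilter, ouFilter, h ⟨ht, le_rfl⟩]
  congr 1
  refine intervalIntegral.integral_congr fun u hu => ?_
  rw [uIcc_of_le ht] at hu
  simp only [h hu]

theorem ouFilter_const_mul (c : ℝ) (f : ℝ → ℝ) (t : ℝ) :
    ouFilter (fun u => c * f u) t = c * ouFilter f t := by
  simp only [ouFilter, mul_sub, ← intervalIntegral.integral_const_mul, smul_eq_mul,
    mul_left_comm]

theorem continuous_ouFilter {f : ℝ → E} (hf : Continuous f) : Continuous (ouFilter f) :=
  hf.sub (intervalIntegral.continuous_parametric_intervalIntegral_of_continuous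
    (f := fun t u => exp (-(t - u)) • f u) (by unfold Function.uncurry; fun_prop) continuous_id)

theorem integral_exp_neg_sub (t : ℝ) : ∫ u in (0 : ℝ)..t, exp (-(t - u)) = 1 - exp (-t) := by
  simp only [neg_sub]
  rw [intervalIntegral.integral_comp_sub_right (fun u => exp u), integral_exp, sub_self, exp_zero,
    zero_sub]

theorem norm_ouFilter_le {f : ℝ → E} {t C : ℝ} (ht : 0 ≤ t) (hf : ∀ u ∈ Icc 0 t, ‖f u‖ ≤ C) :
    ‖ouFilter f t‖ ≤ 2 * C := by
  have hC : 0 ≤ C := (norm_nonneg _).trans (hf t ⟨ht, le_rfl⟩)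
  have hint : ‖∫ u in (0 : ℝ)..t, exp (-(t - u)) • f u‖ ≤
      ∫ u in (0 : ℝ)..t, exp (-(t - u)) * C := by
    refine intervalIntegral.norm_integral_le_of_norm_le ht (Eventually.of_forall fun u hu => ?_)
      ((by fun_prop : Continuous _).intervalIntegrable _ _)
    rw [norm_smul, norm_of_nonneg (exp_pos _).le]
    exact mul_le_mul_of_nonneg_left (hf u (Ioc_subset_Icc_self hu)) (exp_pos _).le
  rw [intervalIntegral.integral_mul_const, integral_exp_neg_sub] at hint
  refine (norm_sub_le _ _).trans ?_
  nlinarith [hf t ⟨ht, le_rfl⟩, mul_nonneg (exp_pos (-t)).le hC]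

theorem integrable_exp_smul_prod {α : Type*} [MeasurableSpace α] {μ : Measure α} [SFinite μ]
    {F : ℝ → α → E} {g : α → ℝ} {t : ℝ} (ht : 0 ≤ t)
    (hF : StronglyMeasurable (Function.uncurry F)) (hg : Integrable g μ)
    (hFg : ∀ᵐ l ∂μ, ∀ u ∈ Icc 0 t, ‖F u l‖ ≤ g l) :
    Integrable (Function.uncurry fun u l => exp (-(t - u)) • F u l)
      ((volume.restrict (uIoc 0 t)).prod μ) := by
  have hbound : Integrable (fun p : ℝ × α => (1 : ℝ) * g p.2)
      ((volume.restrict (uIoc 0 t)).prod μ) :=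
    Integrable.mul_prod (f := fun _ : ℝ => (1 : ℝ)) (integrableOn_const (by simp)) hg
  have hexp : Measurable fun p : ℝ × α => exp (-(t - p.1)) := by fun_prop
  refine hbound.mono' (hexp.stronglyMeasurable.smul hF).aestronglyMeasurable ?_
  filter_upwards [Measure.quasiMeasurePreserving_fst.ae (ae_restrict_mem measurableSet_uIoc),
    Measure.quasiMeasurePreserving_snd.ae hFg] with p hp hpg
  rw [uIoc_of_le ht] at hp
  rw [Function.uncurry_def, norm_smul, norm_of_nonneg (exp_pos _).le]
  exact mul_le_mul (exp_le_one_iff.2 (by linarith [hp.2])) (hpg _ (Ioc_subset_Icc_self hp))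
    (norm_nonneg _) zero_le_one

theorem ouFilter_integral {α : Type*} [MeasurableSpace α] {μ : Measure α} [SFinite μ]
    {F : ℝ → α → E} {g : α → ℝ} {t : ℝ} (ht : 0 ≤ t)
    (hF : StronglyMeasurable (Function.uncurry F)) (hg : Integrable g μ)
    (hFg : ∀ᵐ l ∂μ, ∀ u ∈ Icc 0 t, ‖F u l‖ ≤ g l) :
    ouFilter (fun u => ∫ l, F u l ∂μ) t = ∫ l, ouFilter (fun u => F u l) t ∂μ := by
  have hFt : Integrable (F t) μ :=
    hg.mono' (hF.comp_measurable measurable_prodMk_left).aestronglyMeasurable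
      (hFg.mono fun l hl => hl t ⟨ht, le_rfl⟩)
  have hprod := integrable_exp_smul_prod ht hF hg hFg
  have hint : Integrable (fun l => ∫ u in (0 : ℝ)..t, exp (-(t - u)) • F u l) μ := by
    simpa only [intervalIntegral.integral_of_le ht, uIoc_of_le ht, Function.uncurry] using
      hprod.integral_prod_right
  simp only [ouFilter]
  rw [integral_sub hFt hint, ← intervalIntegral_integral_swap hprod]
  simp only [integral_smul]

end Filter

section InnerFilter

variable {E : Type*} [NormedAddCommGroup E] [InnerProductSpace ℝ E] [CompleteSpace E]

theorem inner_intervalIntegral (x : E) {f : ℝ → E} (hf : Continuous f) (a b : ℝ) :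
    inner ℝ x (∫ u in a..b, f u) = ∫ u in a..b, inner ℝ x (f u) :=
  ((innerSL ℝ x).intervalIntegral_comp_comm (hf.intervalIntegrable (μ := volume) a b)).symm

theorem inner_ouFilter (x : E) {f : ℝ → E} (hf : Continuous f) (t : ℝ) :
    inner ℝ x (ouFilter f t) = ouFilter (fun u => inner ℝ x (f u)) t := by
  rw [ouFilter, inner_sub_right, inner_intervalIntegral x (by fun_prop), ouFilter]
  simp only [inner_smul_right, smul_eq_mul]

theorem inner_ouFilter_ouFilter {f g : ℝ → E} (hf : Continuous f) (hg : Continuous g) (t s : ℝ) :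
    inner ℝ (ouFilter f t) (ouFilter g s) =
      ouFilter (fun a => ouFilter (fun u => inner ℝ (f u) (g a)) t) s := by
  rw [inner_ouFilter _ hg]
  congr 1
  ext a
  rw [real_inner_comm, inner_ouFilter _ hf]
  simp only [real_inner_comm]

end InnerFilter

/-! ### The filtered covariance -/

/-- The function `λ ↦ e^{iλu} - 1`, which represents `1_{[0,u]}` in the spectral `L²` space of
fractional Brownian motion. -/
def wave (l u : ℝ) : ℂ := Complex.exp (l * u * Complex.I) - 1

/-- The image of `wave l` under the Ornstein-Uhlenbeck filter. -/
def ouWave (l t : ℝ) : ℂ :=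
  l * Complex.I / (1 + l * Complex.I) * (Complex.exp (l * t * Complex.I) - exp (-t))

theorem continuous_wave (l : ℝ) : Continuous (wave l) := by
  unfold wave
  fun_prop

theorem ouFilter_wave (l t : ℝ) : ouFilter (wave l) t = ouWave l t := by
  have hl : 1 + l * Complex.I ≠ 0 := fun h => by simpa using congrArg Complex.re h
  have hsplit : ∀ u : ℝ, exp (-(t - u)) • wave l u = Complex.exp (-t) *
      (Complex.exp ((1 + l * Complex.I) * u) - Complex.exp (1 * u)) := by
    intro u
    rw [wave, Complex.real_smul, Complex.ofReal_exp, mul_sub, mul_sub, ← Complex.exp_add,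
      ← Complex.exp_add, ← Complex.exp_add]
    push_cast
    ring_nf
  have hint : ∀ c : ℂ, IntervalIntegrable (fun u : ℝ => Complex.exp (c * u)) volume 0 t :=
    fun c => (by fun_prop : Continuous _).intervalIntegrable _ _
  have hexp : Complex.exp ((1 + l * Complex.I) * t) =
      Complex.exp t * Complex.exp (l * t * Complex.I) := by
    rw [← Complex.exp_add]; ring_nf
  have hinv : Complex.exp (-t) * Complex.exp t = 1 := by
    rw [← Complex.exp_add, neg_add_cancel, Complex.exp_zero]
  simp only [ouFilter, hsplit]
  rw [intervalIntegral.integral_const_mul, intervalIntegral.integral_sub (hint _) (hint _),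
    integral_exp_mul_complex hl, integral_exp_mul_complex one_ne_zero, hexp, wave, ouWave]
  simp only [Complex.ofReal_zero, mul_zero, Complex.exp_zero, one_mul, div_one, Complex.ofReal_exp,
    Complex.ofReal_neg]
  field_simp
  linear_combination (l * Complex.I + 1 - Complex.exp (l * t * Complex.I)) * hinv

theorem norm_wave_sq_le (l u : ℝ) : ‖wave l u‖ ^ 2 ≤ (4 + u ^ 2) * (l ^ 2 / (1 + l ^ 2)) := by
  have hnorm : ‖wave l u‖ ^ 2 = 2 - 2 * cos (l * u) := by
    rw [wave, Complex.sq_norm, Complex.normSq_apply, ← Complex.ofReal_mul]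
    simp only [Complex.sub_re, Complex.sub_im, Complex.exp_ofReal_mul_I_re,
      Complex.exp_ofReal_mul_I_im, Complex.one_re, Complex.one_im]
    linear_combination sin_sq_add_cos_sq (l * u)
  rw [hnorm, ← mul_div_assoc, le_div_iff₀ (by positivity)]
  nlinarith [sq_nonneg l, one_sub_sq_div_two_le_cos (x := l * u), neg_one_le_cos (l * u)]

theorem inner_wave (l u a : ℝ) :
    inner ℝ (wave l a) (wave l u) =
      1 - cos (u * l) + (1 - cos (a * l)) - (1 - cos ((u - a) * l)) := by
  simp only [Complex.inner, wave, ← Complex.ofReal_mul, Complex.mul_re, Complex.conj_re,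
    Complex.conj_im, Complex.sub_re, Complex.sub_im, Complex.exp_ofReal_mul_I_re,
    Complex.exp_ofReal_mul_I_im, Complex.one_re, Complex.one_im]
  rw [sub_mul u, cos_sub, mul_comm l u, mul_comm l a]
  ring

theorem inner_ouWave (l t s : ℝ) :
    inner ℝ (ouWave l t) (ouWave l s) = l ^ 2 / (1 + l ^ 2) *
      (cos ((t - s) * l) - exp (-s) * cos (t * l) - exp (-t) * cos (s * l) +
        exp (-t) * exp (-s)) := by
  have hmul : ∀ z x y : ℂ, inner ℝ (z * x) (z * y) = Complex.normSq z * inner ℝ x y := by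
    intro z x y
    simp only [Complex.inner, Complex.normSq_apply, map_mul, Complex.mul_re, Complex.mul_im,
      Complex.conj_re, Complex.conj_im]
    ring
  have hz : Complex.normSq (l * Complex.I / (1 + l * Complex.I)) = l ^ 2 / (1 + l ^ 2) := by
    simp [Complex.normSq_apply, sq]
  simp only [ouWave, hmul, hz]
  simp only [Complex.inner, ← Complex.ofReal_mul, Complex.mul_re, Complex.conj_re,
    Complex.conj_im, Complex.sub_re, Complex.sub_im, Complex.exp_ofReal_mul_I_re,
    Complex.exp_ofReal_mul_I_im, Complex.ofReal_re, Complex.ofReal_im]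
  rw [sub_mul t, cos_sub, mul_comm l t, mul_comm l s]
  ring

theorem norm_ouWave_sq_le (l : ℝ) {t : ℝ} (ht : 0 ≤ t) :
    ‖ouWave l t‖ ^ 2 ≤ 4 * (l ^ 2 / (1 + l ^ 2)) := by
  rw [← real_inner_self_eq_norm_sq, inner_ouWave, mul_comm (4 : ℝ), sub_self, zero_mul, cos_zero]
  refine mul_le_mul_of_nonneg_left ?_ (by positivity)
  have hexp : exp (-t) ≤ 1 := exp_le_one_iff.2 (by linarith)
  nlinarith [exp_pos (-t), neg_one_le_cos (t * l)]

theorem abs_real_inner_le_add_div_two {E : Type*} [NormedAddCommGroup E] [InnerProductSpace ℝ E]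
    (x y : E) : |inner ℝ x y| ≤ (‖x‖ ^ 2 + ‖y‖ ^ 2) / 2 := by
  have h := abs_real_inner_le_norm x y
  linarith [two_mul_le_add_sq ‖x‖ ‖y‖]

theorem ouFilter_integral_inner_wave {H : ℝ} (h0 : 0 < H) (h1 : H < 1) {ψ : ℝ → ℂ} {M t : ℝ}
    (ht : 0 ≤ t) (hψ : Measurable ψ) (hM : ∀ l, ‖ψ l‖ ^ 2 ≤ M * (l ^ 2 / (1 + l ^ 2))) :
    ouFilter (fun u => specConst H *
      ∫ l in Ioi (0 : ℝ), inner ℝ (ψ l) (wave l u) * l ^ (-1 - 2 * H)) t =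
    specConst H * ∫ l in Ioi (0 : ℝ), inner ℝ (ψ l) (ouWave l t) * l ^ (-1 - 2 * H) := by
  have hmeas : Measurable (Function.uncurry fun u l : ℝ =>
      inner ℝ (ψ l) (wave l u) * l ^ (-1 - 2 * H)) := by
    unfold Function.uncurry wave
    fun_prop
  rw [ouFilter_const_mul, ouFilter_integral ht hmeas.stronglyMeasurable
    ((integrableOn_specWeight h0 h1).const_mul ((M + (4 + t ^ 2)) / 2))
    (ae_restrict_of_forall_mem measurableSet_Ioi fun l hl u hu => ?_)]
  · simp only [mul_comm _ ((_ : ℝ) ^ (-1 - 2 * H)), ouFilter_const_mul,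
      ← inner_ouFilter _ (continuous_wave _), ouFilter_wave]
  · have hu2 : u ^ 2 ≤ t ^ 2 := pow_le_pow_left₀ hu.1 hu.2 2
    rw [norm_mul, norm_of_nonneg (rpow_nonneg (le_of_lt hl) _), specWeight_eq_sq_div_mul_rpow H hl,
      ← mul_assoc]
    refine mul_le_mul_of_nonneg_right ?_ (rpow_nonneg (le_of_lt hl) _)
    refine (abs_real_inner_le_add_div_two _ _).trans ?_
    nlinarith [hM l, norm_wave_sq_le l u]

theorem cov_eq_integral_inner_wave {H : ℝ} (h0 : 0 < H) (h1 : H < 1) (u a : ℝ) :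
    cov H u a = specConst H *
      ∫ l in Ioi (0 : ℝ), inner ℝ (wave l a) (wave l u) * l ^ (-1 - 2 * H) := by
  have hint := fun r => integrableOn_one_sub_cos H h0 h1 r
  have hadd : IntegrableOn (fun l : ℝ => (1 - cos (u * l)) * l ^ (-1 - 2 * H) +
    (1 - cos (a * l)) * l ^ (-1 - 2 * H)) (Ioi 0) := (hint u).add (hint a)
  simp only [inner_wave, sub_mul _ _ ((_ : ℝ) ^ (-1 - 2 * H)), add_mul]
  simp only [← sub_mul]
  rw [integral_sub hadd (hint (u - a)), integral_add (hint _) (hint _),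
    integral_one_sub_cos H h0, integral_one_sub_cos H h0, integral_one_sub_cos H h0, cov]
  linear_combination (-(|u| ^ (2 * H) + |a| ^ (2 * H) - |u - a| ^ (2 * H)) / 2) *
    two_mul_specConst_mul_integral_one_sub_cos h0 h1

/-- The covariance function of `Z_t - e^{-t} Z_0`, where `Z` is a stationary process with covariance
function `ρ`. -/
def startedCov (ρ : ℝ → ℝ) (t s : ℝ) : ℝ :=
  ρ (t - s) - exp (-s) * ρ t - exp (-t) * ρ s + exp (-t) * exp (-s) * ρ 0

theorem specConst_mul_integral_inner_ouWave {H : ℝ} (h0 : 0 < H) (h1 : H < 1) (t s : ℝ) :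
    specConst H * ∫ l in Ioi (0 : ℝ), inner ℝ (ouWave l t) (ouWave l s) * l ^ (-1 - 2 * H) =
      startedCov (ouCov H) t s := by
  have hint := integrableOn_cos_mul_specWeight h0 h1
  have hsub : ∀ x y, IntegrableOn (fun l => cos (x * l) * specWeight H l -
      exp (-s) * (cos (y * l) * specWeight H l)) (Ioi 0) :=
    fun x y => (hint x).sub ((hint y).const_mul _)
  have hval : ∀ x y, ∫ l in Ioi (0 : ℝ), (cos (x * l) * specWeight H l -
      exp (-s) * (cos (y * l) * specWeight H l)) =
      (∫ l in Ioi (0 : ℝ), cos (x * l) * specWeight H l) -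
        exp (-s) * ∫ l in Ioi (0 : ℝ), cos (y * l) * specWeight H l := fun x y => by
    rw [integral_sub (hint x) ((hint y).const_mul _), integral_const_mul]
  have hsplit : ∀ l ∈ Ioi (0 : ℝ), inner ℝ (ouWave l t) (ouWave l s) * l ^ (-1 - 2 * H) =
      cos ((t - s) * l) * specWeight H l - exp (-s) * (cos (t * l) * specWeight H l) -
        exp (-t) * (cos (s * l) * specWeight H l -
          exp (-s) * (cos (0 * l) * specWeight H l)) := by
    intro l hl
    rw [inner_ouWave, specWeight_eq_sq_div_mul_rpow H hl, zero_mul, cos_zero]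
    ring
  rw [setIntegral_congr_fun measurableSet_Ioi hsplit,
    integral_sub (hsub (t - s) t) ((hsub s 0).const_mul (exp (-t))), integral_const_mul, hval,
    hval, startedCov, ouCov, ouCov, ouCov, ouCov]
  ring

theorem ouFilter_ouFilter_cov {H : ℝ} (h0 : 0 < H) (h1 : H < 1) {t s : ℝ} (ht : 0 ≤ t)
    (hs : 0 ≤ s) :
    ouFilter (fun a => ouFilter (fun u => cov H u a) t) s = startedCov (ouCov H) t s := by
  have hfirst : ∀ a, ouFilter (fun u => cov H u a) t = specConst H *
      ∫ l in Ioi (0 : ℝ), inner ℝ (ouWave l t) (wave l a) * l ^ (-1 - 2 * H) := by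
    intro a
    simp only [cov_eq_integral_inner_wave h0 h1]
    rw [ouFilter_integral_inner_wave h0 h1 ht (by unfold wave; fun_prop)
      fun l => norm_wave_sq_le l a]
    simp only [real_inner_comm]
  simp only [hfirst]
  rw [ouFilter_integral_inner_wave h0 h1 hs (by unfold ouWave; fun_prop)
    fun l => norm_ouWave_sq_le l ht, specConst_mul_integral_inner_ouWave h0 h1]

/-! ### The derivative of the covariance -/

theorem continuous_cov {H : ℝ} (h0 : 0 < H) (a : ℝ) : Continuous fun u => cov H u a := by
  have habs : Continuous fun x : ℝ => |x| ^ (2 * H) :=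
    continuous_abs.rpow_const fun _ => Or.inr (by linarith)
  exact ((habs.add continuous_const).sub (habs.comp (continuous_sub_right a))).div_const 2

theorem hasDerivAt_abs_rpow (p : ℝ) {x : ℝ} (hx : x ≠ 0) :
    HasDerivAt (fun x : ℝ => |x| ^ p) (SignType.sign x * (p * |x| ^ (p - 1))) x :=
  ((hasDerivAt_abs hx).rpow_const (Or.inl (abs_ne_zero.2 hx))).congr_deriv (mul_assoc _ _ _)

theorem hasDerivAt_cov (H : ℝ) {u a : ℝ} (hu : u ≠ 0) (hua : u ≠ a) :
    HasDerivAt (fun u => cov H u a)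
      ((SignType.sign u * (2 * H * |u| ^ (2 * H - 1)) -
        SignType.sign (u - a) * (2 * H * |u - a| ^ (2 * H - 1))) / 2) u := by
  have hsub := (hasDerivAt_abs_rpow (2 * H) (sub_ne_zero.2 hua)).comp_sub_const u a
  exact (((hasDerivAt_abs_rpow (2 * H) hu).add_const (|a| ^ (2 * H))).sub hsub).div_const 2

theorem intervalIntegrable_abs_rpow {p : ℝ} (hp : -1 < p) (a b : ℝ) :
    IntervalIntegrable (fun x : ℝ => |x| ^ p) volume a b := by
  refine intervalIntegrable_of_even (fun x => by rw [abs_neg]) fun y hy =>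
    (intervalIntegral.intervalIntegrable_rpow' hp).congr fun z hz => ?_
  rw [uIoc_of_le hy.le] at hz
  simp only [abs_of_pos hz.1]

theorem intervalIntegrable_deriv_cov {H : ℝ} (h0 : 0 < H) (a b c : ℝ) :
    IntervalIntegrable (deriv fun u => cov H u a) volume b c := by
  have hpow := intervalIntegrable_abs_rpow (p := 2 * H - 1) (by linarith)
  have hsub : IntervalIntegrable (fun u => |u - a| ^ (2 * H - 1)) volume b c := by
    simpa using (hpow (b - a) (c - a)).comp_sub_right a
  have hsign : ∀ x y : ℝ, |SignType.sign x * (2 * H * |y| ^ (2 * H - 1))| ≤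
      2 * H * |y| ^ (2 * H - 1) := fun x y => by
    have hnonneg : 0 ≤ 2 * H * |y| ^ (2 * H - 1) := by positivity
    rcases lt_trichotomy x 0 with h | h | h <;> simp [h, abs_of_nonneg hnonneg, hnonneg]
  refine (((hpow b c).add hsub).const_mul H).mono_fun' (measurable_deriv _).aestronglyMeasurable
    (ae_restrict_of_ae ?_)
  filter_upwards [Measure.ae_ne volume a, Measure.ae_ne volume 0] with u hua hu
  rw [(hasDerivAt_cov H hu hua).deriv, norm_eq_abs, abs_div, abs_two, div_le_iff₀ two_pos]
  refine (abs_sub _ _).trans ((add_le_add (hsign _ _) (hsign _ _)).trans (le_of_eq ?_))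
  ring

theorem hasDerivAt_exp_neg_sub (t u : ℝ) :
    HasDerivAt (fun u => exp (-(t - u))) (exp (-(t - u))) u := by
  simpa using (((hasDerivAt_id u).const_sub t).neg).exp

theorem integral_exp_mul_deriv_cov {H : ℝ} (h0 : 0 < H) (a : ℝ) {t : ℝ} (ht : 0 ≤ t) :
    ∫ u in (0 : ℝ)..t, exp (-(t - u)) * deriv (fun u => cov H u a) u =
      ouFilter (fun u => cov H u a) t := by
  have hcov := continuous_cov h0 a
  have hint : IntervalIntegrable (fun u => exp (-(t - u)) * cov H u a) volume 0 t :=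
    (Continuous.mul (by fun_prop) hcov).intervalIntegrable _ _
  have hint_deriv : IntervalIntegrable (fun u => exp (-(t - u)) * deriv (fun u => cov H u a) u)
      volume 0 t := (intervalIntegrable_deriv_cov h0 a 0 t).continuousOn_mul (by fun_prop)
  have hderiv : ∀ u ∈ Ioo 0 t \ {0, a}, HasDerivAt (fun u => exp (-(t - u)) * cov H u a)
      (exp (-(t - u)) * cov H u a + exp (-(t - u)) * deriv (fun u => cov H u a) u) u := by
    rintro u ⟨-, hu⟩
    obtain ⟨hu0, hua⟩ : u ≠ 0 ∧ u ≠ a := by simpa using hu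
    exact (hasDerivAt_exp_neg_sub t u).mul
      (hasDerivAt_cov H hu0 hua).differentiableAt.hasDerivAt
  have hparts := integral_eq_of_hasDerivAt_off_countable_of_le
    (fun u => exp (-(t - u)) * cov H u a) _ ht (Set.toFinite {0, a}).countable
    (Continuous.mul (by fun_prop) hcov).continuousOn hderiv (hint.add hint_deriv)
  have hzero : cov H 0 a = 0 := by simp [cov, zero_rpow (by linarith : 2 * H ≠ 0)]
  rw [intervalIntegral.integral_add hint hint_deriv, sub_self, neg_zero, exp_zero, one_mul, hzero,
    mul_zero, sub_zero] at hparts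
  exact eq_sub_of_add_eq' hparts

/-! ### The exponential kernel as a superposition of product kernels -/

/-- The kernel `e^{-(r-u)} 1_{u ≤ r}` of the Ornstein-Uhlenbeck filter. -/
def expKernel (r u : ℝ) : ℝ := if u ≤ r then exp (-(r - u)) else 0

theorem measurable_uncurry_expKernel : Measurable (Function.uncurry expKernel) :=
  Measurable.ite (measurableSet_le measurable_snd measurable_fst) (by fun_prop) measurable_const

theorem norm_expKernel_mul_expKernel_le (r u v : ℝ) : ‖expKernel r u * expKernel r v‖ ≤ 1 := by
  have hle : ∀ w, |expKernel r w| ≤ 1 := fun w => by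
    unfold expKernel
    split_ifs with h
    · rw [abs_exp]
      exact exp_le_one_iff.2 (by linarith)
    · simp
  rw [norm_mul]
  exact mul_le_one₀ (hle u) (abs_nonneg _) (hle v)

theorem expKernel_mul_expKernel (r u v : ℝ) :
    expKernel r u * expKernel r v =
      (Ici (max u v)).indicator (fun r => exp (u + v) * exp (-2 * r)) r := by
  by_cases hr : max u v ≤ r
  · rw [indicator_of_mem (mem_Ici.2 hr), expKernel, expKernel,
      if_pos ((le_max_left u v).trans hr), if_pos ((le_max_right u v).trans hr), ← exp_add,
      ← exp_add]
    ring_nf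
  · rw [indicator_of_notMem (mt mem_Ici.1 hr)]
    rcases lt_max_iff.1 (not_le.1 hr) with h | h <;> simp [expKernel, not_le.2 h]

theorem exp_neg_abs_sub_eq {T u v : ℝ} (hu : u ∈ Icc 0 T) (hv : v ∈ Icc 0 T) :
    exp (-|u - v|) = 2 * (∫ r in (0 : ℝ)..T, expKernel r u * expKernel r v) +
      expKernel T u * expKernel T v := by
  have hmT : max u v ≤ T := max_le hu.2 hv.2
  have hIcc : Icc 0 T ∩ Ici (max u v) = Icc (max u v) T := by
    rw [inter_comm, ← Ici_inter_Iic, ← inter_assoc, Ici_inter_Ici,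
      sup_eq_left.2 (le_max_of_le_left hu.1), Ici_inter_Iic]
  have hmax : -|u - v| = u + v + -2 * max u v := by
    linarith [max_sub_min_eq_abs' u v, max_add_min u v]
  simp only [expKernel_mul_expKernel]
  rw [intervalIntegral.integral_of_le (hu.1.trans hu.2), ← integral_Icc_eq_integral_Ioc,
    setIntegral_indicator measurableSet_Ici, hIcc, integral_Icc_eq_integral_Ioc,
    ← intervalIntegral.integral_of_le hmT, intervalIntegral.integral_const_mul,
    intervalIntegral.integral_comp_mul_left (fun x => exp x) (by norm_num), integral_exp,
    indicator_of_mem (mem_Ici.2 hmT), hmax, exp_add, smul_eq_mul]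
  ring

theorem setIntegral_expKernel_mul {r T : ℝ} (hr : r ∈ Icc 0 T) (f : ℝ → ℝ) :
    ∫ u in Icc 0 T, expKernel r u * f u = ∫ u in (0 : ℝ)..r, exp (-(r - u)) * f u := by
  have hindicator : ∀ u, expKernel r u * f u =
      (Iic r).indicator (fun u => exp (-(r - u)) * f u) u := fun u => by
    simp only [expKernel, indicator, mem_Iic, ite_mul, zero_mul]
  simp only [hindicator]
  rw [setIntegral_indicator measurableSet_Iic, ← Ici_inter_Iic, inter_assoc, Iic_inter_Iic,
    inf_eq_right.2 hr.2, Ici_inter_Iic, integral_Icc_eq_integral_Ioc,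
    intervalIntegral.integral_of_le hr.1]

theorem setIntegral_expKernel_mul_prod {r T : ℝ} (hr : r ∈ Icc 0 T) (f g : ℝ → ℝ) :
    ∫ p in Icc (0 : ℝ) T ×ˢ Icc (0 : ℝ) T, expKernel r p.1 * expKernel r p.2 * (f p.1 * g p.2) =
      (∫ u in (0 : ℝ)..r, exp (-(r - u)) * f u) * ∫ u in (0 : ℝ)..r, exp (-(r - u)) * g u := by
  simp only [mul_mul_mul_comm (expKernel r _)]
  rw [← setIntegral_expKernel_mul hr, ← setIntegral_expKernel_mul hr, ← setIntegral_prod_mul,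
    Measure.volume_eq_prod]

theorem integrable_expKernel_mul {μ : Measure ℝ} [IsFiniteMeasure μ] {ν : Measure (ℝ × ℝ)}
    [SFinite ν] {F : ℝ × ℝ → ℝ} (hF : Integrable F ν) :
    Integrable (Function.uncurry fun r (p : ℝ × ℝ) =>
      expKernel r p.1 * expKernel r p.2 * F p) (μ.prod ν) := by
  have hmeas : Measurable fun q : ℝ × ℝ × ℝ => expKernel q.1 q.2.1 * expKernel q.1 q.2.2 :=
    (measurable_uncurry_expKernel.comp
      (by fun_prop : Measurable fun q : ℝ × ℝ × ℝ => (q.1, q.2.1))).mul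
    (measurable_uncurry_expKernel.comp
      (by fun_prop : Measurable fun q : ℝ × ℝ × ℝ => (q.1, q.2.2)))
  exact (hF.comp_snd μ).bdd_mul hmeas.aestronglyMeasurable
    (Eventually.of_forall fun q => norm_expKernel_mul_expKernel_le q.1 q.2.1 q.2.2)

theorem setIntegral_exp_neg_abs_sub_mul {T : ℝ} (hT : 0 ≤ T) {F : ℝ × ℝ → ℝ}
    (hF : IntegrableOn F (Icc (0 : ℝ) T ×ˢ Icc (0 : ℝ) T)) :
    ∫ p in Icc (0 : ℝ) T ×ˢ Icc (0 : ℝ) T, exp (-|p.1 - p.2|) * F p =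
      2 * (∫ r in (0 : ℝ)..T, ∫ p in Icc (0 : ℝ) T ×ˢ Icc (0 : ℝ) T,
        expKernel r p.1 * expKernel r p.2 * F p) +
      ∫ p in Icc (0 : ℝ) T ×ˢ Icc (0 : ℝ) T, expKernel T p.1 * expKernel T p.2 * F p := by
  have : IsFiniteMeasure (volume.restrict (uIoc 0 T)) := isFiniteMeasure_restrict_Ioc _ _
  have hprod := integrable_expKernel_mul (μ := volume.restrict (uIoc 0 T)) hF
  have hint : IntegrableOn (fun p => ∫ r in (0 : ℝ)..T, expKernel r p.1 * expKernel r p.2 * F p)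
      (Icc (0 : ℝ) T ×ˢ Icc (0 : ℝ) T) := by
    simpa only [IntegrableOn, intervalIntegral.integral_of_le hT, uIoc_of_le hT,
      Function.uncurry] using hprod.integral_prod_right
  have hlast : IntegrableOn (fun p => expKernel T p.1 * expKernel T p.2 * F p)
      (Icc (0 : ℝ) T ×ˢ Icc (0 : ℝ) T) :=
    hF.bdd_mul ((measurable_uncurry_expKernel.comp (by fun_prop :
      Measurable fun p : ℝ × ℝ => (T, p.1))).mul (measurable_uncurry_expKernel.comp (by fun_prop :
      Measurable fun p : ℝ × ℝ => (T, p.2)))).aestronglyMeasurable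
      (Eventually.of_forall fun p => norm_expKernel_mul_expKernel_le T p.1 p.2)
  rw [intervalIntegral_integral_swap hprod, ← integral_const_mul,
    ← integral_add (hint.const_mul 2) hlast]
  refine setIntegral_congr_fun (measurableSet_Icc.prod measurableSet_Icc) fun p hp => ?_
  simp only [exp_neg_abs_sub_eq hp.1 hp.2, intervalIntegral.integral_mul_const]
  ring

theorem setIntegral_exp_neg_abs_sub_mul_prod {T : ℝ} (hT : 0 ≤ T) {f g : ℝ → ℝ}
    (hf : IntegrableOn f (Icc 0 T)) (hg : IntegrableOn g (Icc 0 T)) :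
    ∫ p in Icc (0 : ℝ) T ×ˢ Icc (0 : ℝ) T, exp (-|p.1 - p.2|) * (f p.1 * g p.2) =
      2 * (∫ r in (0 : ℝ)..T, (∫ u in (0 : ℝ)..r, exp (-(r - u)) * f u) *
        ∫ u in (0 : ℝ)..r, exp (-(r - u)) * g u) +
      (∫ u in (0 : ℝ)..T, exp (-(T - u)) * f u) * ∫ u in (0 : ℝ)..T, exp (-(T - u)) * g u := by
  have hfg : IntegrableOn (fun p : ℝ × ℝ => f p.1 * g p.2) (Icc (0 : ℝ) T ×ˢ Icc (0 : ℝ) T) := by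
    rw [IntegrableOn, Measure.volume_eq_prod, ← Measure.prod_restrict]
    exact Integrable.mul_prod hf hg
  rw [setIntegral_exp_neg_abs_sub_mul hT hfg, setIntegral_expKernel_mul_prod ⟨hT, le_rfl⟩]
  congr 2
  refine intervalIntegral.integral_congr fun r hr => ?_
  rw [uIcc_of_le hT] at hr
  exact setIntegral_expKernel_mul_prod hr f g

/-! ### Hilbert tensor squares -/

section TensorSquare

variable {E : Type*} [NormedAddCommGroup E] [InnerProductSpace ℝ E]

/-- The square `x ⊗ x` in the Hilbert space tensor square of `E`. -/
def tensorSq (x : E) : UniformSpace.Completion (E ⊗[ℝ] E) := ((x ⊗ₜ[ℝ] x : E ⊗[ℝ] E))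

theorem continuous_tensorSq : Continuous (tensorSq : E → UniformSpace.Completion (E ⊗[ℝ] E)) :=
  (UniformSpace.Completion.continuous_coe _).comp
    (TensorProduct.continuous_tmul.comp (continuous_id.prodMk continuous_id))

theorem inner_tensorSq_tmul (x y z : E) :
    inner ℝ (tensorSq x) ((y ⊗ₜ[ℝ] z : E ⊗[ℝ] E) : UniformSpace.Completion (E ⊗[ℝ] E)) =
      inner ℝ x y * inner ℝ x z := by
  rw [tensorSq, UniformSpace.Completion.inner_coe, TensorProduct.inner_tmul]

theorem inner_tensorSq (x y : E) : inner ℝ (tensorSq x) (tensorSq y) = inner ℝ x y ^ 2 := by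
  rw [sq, ← inner_tensorSq_tmul, tensorSq, tensorSq]

theorem norm_tensorSq (x : E) : ‖tensorSq x‖ = ‖x‖ ^ 2 := by
  rw [tensorSq, UniformSpace.Completion.norm_coe, TensorProduct.norm_tmul, sq]

theorem eq_zero_of_inner_tmul_eq_zero {ι : Type*} {v : ι → E}
    (hv : Dense (Submodule.span ℝ (range v) : Set E)) {d : UniformSpace.Completion (E ⊗[ℝ] E)}
    (hd : ∀ i j, inner ℝ d ((v i ⊗ₜ[ℝ] v j : E ⊗[ℝ] E) : UniformSpace.Completion _) = 0) :
    d = 0 := by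
  let L : E →L[ℝ] E →L[ℝ] ℝ :=
    (ContinuousLinearMap.compL ℝ _ _ ℝ ((innerSL ℝ d).comp
      (UniformSpace.Completion.toComplL (𝕜 := ℝ)))).comp (TensorProduct.mkL ℝ E E)
  have hL : L = 0 := ContinuousLinearMap.ext_on hv (forall_mem_range.2 fun i =>
    ContinuousLinearMap.ext_on hv (forall_mem_range.2 fun j => hd i j))
  refine UniformSpace.Completion.denseRange_coe.eq_zero_of_inner_left ℝ fun z => ?_
  induction z using TensorProduct.induction_on with
  | zero => rw [UniformSpace.Completion.coe_zero, inner_zero_right]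
  | tmul x y => exact DFunLike.congr_fun (DFunLike.congr_fun hL x) y
  | add z w hz hw => rw [UniformSpace.Completion.coe_add, inner_add_right, hz, hw, add_zero]

/-- The element `2 ∫_0^T X_r ⊗ X_r dr + X_T ⊗ X_T` of the tensor square. For `X_r` the function
`e^{-(r-·)} 1_{[0,r]}` it is the function `e^{-|u-v|}` on `[0,T]²`. -/
def superposedSq (X : ℝ → E) (T : ℝ) : UniformSpace.Completion (E ⊗[ℝ] E) :=
  (2 : ℝ) • (∫ r in (0 : ℝ)..T, tensorSq (X r)) + tensorSq (X T)

/-- The squared norm of `superposedSq X T` in terms of the Gram kernel `K r q = ⟨X_r, X_q⟩`. -/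
def kernelEnergy (K : ℝ → ℝ → ℝ) (T : ℝ) : ℝ :=
  4 * (∫ r in (0 : ℝ)..T, ∫ q in (0 : ℝ)..T, K r q ^ 2) + 4 * (∫ q in (0 : ℝ)..T, K T q ^ 2) +
    K T T ^ 2

theorem inner_superposedSq {X : ℝ → E} (hX : Continuous X) (T : ℝ)
    (z : UniformSpace.Completion (E ⊗[ℝ] E)) :
    inner ℝ (superposedSq X T) z =
      2 * (∫ r in (0 : ℝ)..T, inner ℝ (tensorSq (X r)) z) + inner ℝ (tensorSq (X T)) z := by
  rw [superposedSq, inner_add_left, real_inner_smul_left, real_inner_comm,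
    inner_intervalIntegral z (f := fun r => tensorSq (X r)) (continuous_tensorSq.comp hX)]
  simp only [real_inner_comm z]

theorem norm_superposedSq_sq {X : ℝ → E} (hX : Continuous X) (T : ℝ) :
    ‖superposedSq X T‖ ^ 2 = kernelEnergy (fun r q => inner ℝ (X r) (X q)) T := by
  have hinner : ∀ z, inner ℝ z (∫ q in (0 : ℝ)..T, tensorSq (X q)) =
      ∫ q in (0 : ℝ)..T, inner ℝ z (tensorSq (X q)) :=
    fun z => inner_intervalIntegral z (continuous_tensorSq.comp hX) 0 T
  have hnorm : ‖∫ r in (0 : ℝ)..T, tensorSq (X r)‖ ^ 2 =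
      ∫ r in (0 : ℝ)..T, ∫ q in (0 : ℝ)..T, inner ℝ (X r) (X q) ^ 2 := by
    rw [← real_inner_self_eq_norm_sq, hinner]
    simp only [real_inner_comm (tensorSq _) (∫ r in (0 : ℝ)..T, tensorSq (X r)), hinner,
      inner_tensorSq]
  rw [superposedSq, norm_add_sq_real, norm_smul, mul_pow, hnorm, real_inner_smul_left,
    real_inner_comm, hinner, ← real_inner_self_eq_norm_sq (tensorSq (X T)), kernelEnergy]
  simp only [inner_tensorSq, norm_two]
  ring

theorem norm_superposedSq_le {X : ℝ → E} {T C : ℝ} (hT : 0 ≤ T)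
    (hX : ∀ r ∈ Icc 0 T, ‖X r‖ ≤ C) : ‖superposedSq X T‖ ≤ (2 * T + 1) * C ^ 2 := by
  have hsq : ∀ r ∈ Icc 0 T, ‖tensorSq (X r)‖ ≤ C ^ 2 := fun r hr =>
    (norm_tensorSq _).trans_le (pow_le_pow_left₀ (norm_nonneg _) (hX r hr) 2)
  have hint := intervalIntegral.norm_integral_le_of_norm_le_const
    (f := fun r => tensorSq (X r)) (a := 0) (b := T) fun r hr =>
      hsq r (Ioc_subset_Icc_self (uIoc_of_le hT ▸ hr))
  rw [sub_zero, abs_of_nonneg hT] at hint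
  refine (norm_add_le _ _).trans ?_
  rw [norm_smul, norm_two]
  linarith [hsq T ⟨hT, le_rfl⟩]

end TensorSquare

/-! ### The Ornstein-Uhlenbeck curve in the canonical space -/

section CanonicalSpace

variable (H : Ioo (0 : ℝ) 1) {T : ℝ}

theorem norm_ind (t : Icc (0 : ℝ) T) : ‖ind H T t‖ = (t : ℝ) ^ (H : ℝ) := by
  have hH : 2 * (H : ℝ) ≠ 0 := by linarith [H.2.1]
  refine (sq_eq_sq₀ (norm_nonneg _) (rpow_nonneg t.2.1 _)).1 ?_
  rw [← real_inner_self_eq_norm_sq, inner_ind, cov, sub_self, abs_zero, zero_rpow hH,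
    abs_of_nonneg t.2.1, ← rpow_mul_natCast t.2.1, Nat.cast_two, mul_comm (H : ℝ)]
  ring

theorem norm_ind_sub (s t : Icc (0 : ℝ) T) :
    ‖ind H T s - ind H T t‖ = |(s : ℝ) - t| ^ (H : ℝ) := by
  have hH : 2 * (H : ℝ) ≠ 0 := by linarith [H.2.1]
  refine (sq_eq_sq₀ (norm_nonneg _) (rpow_nonneg (abs_nonneg _) _)).1 ?_
  rw [norm_sub_sq_real, ← real_inner_self_eq_norm_sq, ← real_inner_self_eq_norm_sq, inner_ind,
    inner_ind, inner_ind, ← rpow_mul_natCast (abs_nonneg _), Nat.cast_two, mul_comm (H : ℝ)]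
  simp only [cov, sub_self, abs_zero, zero_rpow hH]
  ring

theorem continuous_ind : Continuous (ind H T) := by
  refine continuous_iff_continuousAt.2 fun s => tendsto_iff_norm_sub_tendsto_zero.2 ?_
  have hpow : Continuous fun t : Icc (0 : ℝ) T => |(t : ℝ) - s| ^ (H : ℝ) :=
    (by fun_prop : Continuous fun t : Icc (0 : ℝ) T => |(t : ℝ) - s|).rpow_const
      fun _ => Or.inr H.2.1.le
  simpa only [norm_ind_sub, sub_self, abs_zero, zero_rpow H.2.1.ne'] using hpow.tendsto s

theorem dense_span_range_ind :
    Dense (Submodule.span ℝ (range (ind H T)) : Set (CanonicalSpace H T)) := by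
  refine UniformSpace.Completion.denseRange_coe.mono ?_
  rintro _ ⟨x, rfl⟩
  induction x using Finsupp.induction_linear with
  | zero => exact Submodule.zero_mem _
  | add x y hx hy =>
    exact (UniformSpace.Completion.coe_add (α := Step H T) x y) ▸ Submodule.add_mem _ hx hy
  | single t c =>
    have hsingle : (Finsupp.single t c : Icc (0 : ℝ) T →₀ ℝ) = c • stepInd H T t :=
      (Finsupp.smul_single_one t c).symm
    rw [hsingle]
    exact (UniformSpace.Completion.coe_smul (X := Step H T) c (stepInd H T t)) ▸
      Submodule.smul_mem _ c (Submodule.subset_span (mem_range_self t))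

variable (hT : 0 ≤ T)

/-- The curve `t ↦ 1_[0,t]`, extended from `[0,T]` to the real line by constants. -/
def indCurve (t : ℝ) : CanonicalSpace H T := ind H T (projIcc 0 T hT t)

theorem continuous_indCurve : Continuous (indCurve H hT) :=
  (continuous_ind H).comp continuous_projIcc

theorem inner_ind_indCurve (a : Icc (0 : ℝ) T) {t : ℝ} (ht : t ∈ Icc 0 T) :
    inner ℝ (ind H T a) (indCurve H hT t) = cov H t a := by
  rw [real_inner_comm, indCurve, inner_ind, projIcc_of_mem hT ht]

theorem inner_indCurve {t s : ℝ} (ht : t ∈ Icc 0 T) (hs : s ∈ Icc 0 T) :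
    inner ℝ (indCurve H hT t) (indCurve H hT s) = cov H t s := by
  rw [indCurve, indCurve, inner_ind, projIcc_of_mem hT ht, projIcc_of_mem hT hs]

theorem norm_indCurve {t : ℝ} (ht : t ∈ Icc 0 T) : ‖indCurve H hT t‖ = t ^ (H : ℝ) := by
  rw [indCurve, norm_ind, projIcc_of_mem hT ht]

/-- The curve in the canonical space whose value at `t` is the function
`u ↦ e^{-(t-u)} 1_{[0,t]}(u)`. -/
def ouCurve : ℝ → CanonicalSpace H T := ouFilter (indCurve H hT)

theorem continuous_ouCurve : Continuous (ouCurve H hT) :=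
  continuous_ouFilter (continuous_indCurve H hT)

theorem inner_ouCurve_ind {t : ℝ} (ht : t ∈ Icc 0 T) (a : Icc (0 : ℝ) T) :
    inner ℝ (ouCurve H hT t) (ind H T a) =
      ∫ u in (0 : ℝ)..t, exp (-(t - u)) * deriv (fun u => cov H u a) u := by
  rw [real_inner_comm, ouCurve, inner_ouFilter _ (continuous_indCurve H hT),
    integral_exp_mul_deriv_cov H.2.1 _ ht.1]
  exact ouFilter_congr ht.1 fun u hu => inner_ind_indCurve H hT a ⟨hu.1, hu.2.trans ht.2⟩

theorem inner_ouCurve_ouCurve {t s : ℝ} (ht : t ∈ Icc 0 T) (hs : s ∈ Icc 0 T) :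
    inner ℝ (ouCurve H hT t) (ouCurve H hT s) = startedCov (ouCov H) t s := by
  have hcont := continuous_indCurve H hT
  rw [ouCurve, inner_ouFilter_ouFilter hcont hcont, ← ouFilter_ouFilter_cov H.2.1 H.2.2 ht.1 hs.1]
  exact ouFilter_congr hs.1 fun a ha => ouFilter_congr ht.1 fun u hu =>
    inner_indCurve H hT ⟨hu.1, hu.2.trans ht.2⟩ ⟨ha.1, ha.2.trans hs.2⟩

theorem norm_ouCurve_le {t : ℝ} (ht : t ∈ Icc 0 T) : ‖ouCurve H hT t‖ ≤ 2 * T ^ (H : ℝ) :=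
  norm_ouFilter_le ht.1 fun _ hu => (norm_indCurve H hT ⟨hu.1, hu.2.trans ht.2⟩).trans_le
    (rpow_le_rpow hu.1 (hu.2.trans ht.2) H.2.1.le)

theorem isElement_superposedSq_ouCurve :
    IsElement H T (fT T) (superposedSq (ouCurve H hT) T) := by
  intro a b
  have hderiv : ∀ a, IntegrableOn (deriv fun u => cov H u a) (Icc 0 T) := fun a =>
    (intervalIntegrable_iff_integrableOn_Icc_of_le hT).1 (intervalIntegrable_deriv_cov H.2.1 a 0 T)
  have hfT : EqOn (fun p : ℝ × ℝ => exp (-|p.1 - p.2|) *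
      (deriv (fun u => cov H u a) p.1 * deriv (fun v => cov H v b) p.2))
      (fun p => fT T p.1 p.2 * deriv (fun u => cov H u a) p.1 * deriv (fun v => cov H v b) p.2)
      (Icc (0 : ℝ) T ×ˢ Icc (0 : ℝ) T) := fun p hp => by
    simp only [fT, indicator_of_mem hp, mul_assoc]
  have hmeas : MeasurableSet (Icc (0 : ℝ) T ×ˢ Icc (0 : ℝ) T) :=
    measurableSet_Icc.prod measurableSet_Icc
  constructor
  · have hprod := (hderiv a).mul_prod (hderiv b)
    rw [Measure.prod_restrict, ← Measure.volume_eq_prod] at hprod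
    refine (integrableOn_congr_fun hfT hmeas).1 (hprod.bdd_mul (c := 1)
      (by fun_prop : Measurable _).aestronglyMeasurable (Eventually.of_forall fun p => ?_))
    rw [norm_of_nonneg (exp_pos _).le]
    exact exp_le_one_iff.2 (neg_nonpos.2 (abs_nonneg _))
  · rw [← setIntegral_congr_fun hmeas hfT,
      setIntegral_exp_neg_abs_sub_mul_prod hT (hderiv a) (hderiv b),
      inner_superposedSq (continuous_ouCurve H hT)]
    simp only [ind₂, inner_tensorSq_tmul]
    rw [inner_ouCurve_ind H hT ⟨hT, le_rfl⟩, inner_ouCurve_ind H hT ⟨hT, le_rfl⟩]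
    congr 2
    refine intervalIntegral.integral_congr fun r hr => ?_
    rw [uIcc_of_le hT] at hr
    simp only [inner_ouCurve_ind H hT hr]

theorem IsElement.unique {f : ℝ → ℝ → ℝ} {h k : TensorSquare H T} (hh : IsElement H T f h)
    (hk : IsElement H T f k) : h = k := by
  refine sub_eq_zero.1 (eq_zero_of_inner_tmul_eq_zero (dense_span_range_ind H) fun a b => ?_)
  exact (inner_sub_left _ _ _).trans (sub_eq_zero.2 ((hh a b).2.trans (hk a b).2.symm))

include hT

theorem existsUnique_isElement_fT : ∃! h, IsElement H T (fT T) h :=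
  ⟨_, isElement_superposedSq_ouCurve H hT,
    fun _ hk => hk.unique H (isElement_superposedSq_ouCurve H hT)⟩

theorem IsElement.norm_sq_eq {h : TensorSquare H T} (hh : IsElement H T (fT T) h) :
    ‖h‖ ^ 2 = kernelEnergy (startedCov (ouCov H)) T := by
  have hcongr : ∀ r ∈ Icc 0 T, ∫ q in (0 : ℝ)..T, inner ℝ (ouCurve H hT r) (ouCurve H hT q) ^ 2 =
      ∫ q in (0 : ℝ)..T, startedCov (ouCov H) r q ^ 2 := fun r hr =>
    intervalIntegral.integral_congr fun q hq => by
      simp only [inner_ouCurve_ouCurve H hT hr (uIcc_of_le hT ▸ hq)]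
  have hTT : T ∈ Icc 0 T := ⟨hT, le_rfl⟩
  rw [hh.unique H (isElement_superposedSq_ouCurve H hT),
    norm_superposedSq_sq (continuous_ouCurve H hT), kernelEnergy, kernelEnergy, hcongr T hTT,
    inner_ouCurve_ouCurve H hT hTT hTT]
  congr 3
  exact intervalIntegral.integral_congr fun r hr => hcongr r (uIcc_of_le hT ▸ hr)

theorem IsElement.norm_sq_le {h : TensorSquare H T} (hh : IsElement H T (fT T) h) :
    ‖h‖ ^ 2 ≤ (2 * T + 1) ^ 2 * (16 * T ^ (4 * (H : ℝ))) := by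
  have hle := norm_superposedSq_le hT fun r hr => norm_ouCurve_le H hT hr
  rw [hh.unique H (isElement_superposedSq_ouCurve H hT)]
  refine (pow_le_pow_left₀ (norm_nonneg _) hle 2).trans_eq ?_
  have hpow : T ^ (4 * (H : ℝ)) = (T ^ (H : ℝ)) ^ 4 := by
    rw [← rpow_mul_natCast hT, mul_comm]
    norm_num
  rw [hpow]
  ring

end CanonicalSpace

/-! ### Asymptotics of the kernel energy of a started stationary process -/

section Asymptotics

variable {ρ : ℝ → ℝ} {T : ℝ}

/-- The primitive of `ρ²`, whose integral governs the growth of the kernel energy. -/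
def sqPrimitive (ρ : ℝ → ℝ) (r : ℝ) : ℝ := ∫ x in (0 : ℝ)..r, ρ x ^ 2

theorem sqPrimitive_nonneg {r : ℝ} (hr : 0 ≤ r) : 0 ≤ sqPrimitive ρ r :=
  intervalIntegral.integral_nonneg hr fun _ _ => sq_nonneg _

theorem continuous_sqPrimitive (hc : Continuous ρ) : Continuous (sqPrimitive ρ) :=
  intervalIntegral.continuous_primitive (fun a b => (hc.pow 2).intervalIntegrable a b) 0

theorem monotone_sqPrimitive (hc : Continuous ρ) : Monotone (sqPrimitive ρ) := by
  intro r s h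
  have hi : ∀ a b, IntervalIntegrable (fun x => ρ x ^ 2) volume a b := fun a b =>
    (hc.pow 2).intervalIntegrable a b
  rw [← sub_nonneg, sqPrimitive, sqPrimitive,
    intervalIntegral.integral_interval_sub_left (hi 0 s) (hi 0 r)]
  exact intervalIntegral.integral_nonneg h fun _ _ => sq_nonneg _

theorem integral_sub_sq (hc : Continuous ρ) (he : ∀ x, ρ (-x) = ρ x) (r T : ℝ) :
    ∫ q in (0 : ℝ)..T, ρ (r - q) ^ 2 = sqPrimitive ρ r + sqPrimitive ρ (T - r) := by
  have hi : ∀ a b, IntervalIntegrable (fun x => ρ x ^ 2) volume a b := fun a b =>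
    (hc.pow 2).intervalIntegrable a b
  have hneg : ∫ x in (r - T)..0, ρ x ^ 2 = sqPrimitive ρ (T - r) := by
    have h := intervalIntegral.integral_comp_neg (a := 0) (b := T - r) fun x => ρ x ^ 2
    simpa only [sqPrimitive, he, neg_sub, neg_zero] using h.symm
  rw [intervalIntegral.integral_comp_sub_left (fun x => ρ x ^ 2) r, sub_zero,
    ← intervalIntegral.integral_add_adjacent_intervals (hi (r - T) 0) (hi 0 r), hneg, add_comm]
  rfl

theorem integral_sub_sq_le (hc : Continuous ρ) (he : ∀ x, ρ (-x) = ρ x) {r : ℝ}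
    (hr : r ∈ Icc 0 T) : ∫ q in (0 : ℝ)..T, ρ (r - q) ^ 2 ≤ 2 * sqPrimitive ρ T := by
  rw [integral_sub_sq hc he, two_mul]
  exact add_le_add (monotone_sqPrimitive hc hr.2)
    (monotone_sqPrimitive hc (sub_le_self T hr.1))

theorem integral_integral_sub_sq (hc : Continuous ρ) (he : ∀ x, ρ (-x) = ρ x) (T : ℝ) :
    ∫ r in (0 : ℝ)..T, ∫ q in (0 : ℝ)..T, ρ (r - q) ^ 2 =
      2 * ∫ r in (0 : ℝ)..T, sqPrimitive ρ r := by
  have hG := continuous_sqPrimitive hc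
  have hG' : Continuous fun r => sqPrimitive ρ (T - r) := hG.comp (by fun_prop)
  simp only [integral_sub_sq hc he]
  rw [intervalIntegral.integral_add (hG.intervalIntegrable _ _) (hG'.intervalIntegrable _ _),
    intervalIntegral.integral_comp_sub_left (sqPrimitive ρ) T, sub_self, sub_zero, two_mul]

theorem integral_exp_neg_le (T : ℝ) : ∫ r in (0 : ℝ)..T, exp (-r) ≤ 1 := by
  rw [intervalIntegral.integral_comp_neg (a := 0) (b := T) exp, neg_zero, integral_exp, exp_zero]
  exact sub_le_self 1 (exp_pos _).le

theorem integral_linear_combination_le (hc : Continuous ρ) (he : ∀ x, ρ (-x) = ρ x) {r : ℝ}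
    (hr : r ∈ Icc 0 T) {a b c : ℝ} (ha : 0 ≤ a) (hcc : 0 ≤ c) :
    ∫ q in (0 : ℝ)..T, (a * ρ (r - q) ^ 2 + b * ρ q ^ 2 + c * exp (-q)) ≤
      (2 * a + b) * sqPrimitive ρ T + c := by
  have hadd : Continuous fun q => a * ρ (r - q) ^ 2 + b * ρ q ^ 2 := by fun_prop
  have hsub : Continuous fun q => a * ρ (r - q) ^ 2 := by fun_prop
  have hself : Continuous fun q => b * ρ q ^ 2 := by fun_prop
  have hexp : Continuous fun q : ℝ => c * exp (-q) := by fun_prop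
  rw [intervalIntegral.integral_add (hadd.intervalIntegrable _ _) (hexp.intervalIntegrable _ _),
    intervalIntegral.integral_add (hsub.intervalIntegrable _ _) (hself.intervalIntegrable _ _),
    intervalIntegral.integral_const_mul, intervalIntegral.integral_const_mul,
    intervalIntegral.integral_const_mul,
    show ∫ q in (0 : ℝ)..T, ρ q ^ 2 = sqPrimitive ρ T from rfl]
  linarith [mul_le_mul_of_nonneg_left (integral_sub_sq_le hc he hr) ha,
    mul_le_mul_of_nonneg_left (integral_exp_neg_le T) hcc]

theorem abs_integral_sub_integral_le {f g h : ℝ → ℝ} (hf : Continuous f) (hg : Continuous g)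
    (hh : Continuous h) (hT : 0 ≤ T) (hfg : ∀ x ∈ Icc 0 T, |f x - g x| ≤ h x) :
    |(∫ x in (0 : ℝ)..T, f x) - ∫ x in (0 : ℝ)..T, g x| ≤ ∫ x in (0 : ℝ)..T, h x := by
  rw [← intervalIntegral.integral_sub (hf.intervalIntegrable _ _) (hg.intervalIntegrable _ _)]
  exact (intervalIntegral.abs_integral_le_integral_abs hT).trans <|
    intervalIntegral.integral_mono_on hT ((hf.sub hg).abs.intervalIntegrable _ _)
      (hh.intervalIntegrable _ _) hfg

theorem integral_integral_swap_of_continuous {F : ℝ → ℝ → ℝ}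
    (hF : Continuous (Function.uncurry F)) (a b c d : ℝ) :
    ∫ r in a..b, ∫ q in c..d, F r q = ∫ q in c..d, ∫ r in a..b, F r q :=
  intervalIntegral_intervalIntegral_swap <|
    (hF.continuousOn.integrableOn_compact (isCompact_uIcc.prod isCompact_uIcc)).mono_set
      (prod_mono uIoc_subset_uIcc uIoc_subset_uIcc)

theorem continuous_startedCov (hc : Continuous ρ) :
    Continuous (Function.uncurry (startedCov ρ)) := by
  unfold Function.uncurry startedCov
  fun_prop

/-- The part, decaying in `r`, of the error made when the started covariance is replaced by the
stationary one; the other part is obtained by exchanging `r` and `q`. -/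
def startedError (ρ : ℝ → ℝ) (r q : ℝ) : ℝ :=
  exp (-r) * (2 * ρ (r - q) ^ 2 + 4 * ρ q ^ 2 + 4 * ρ 0 ^ 2 * exp (-q))

theorem continuous_startedError (hc : Continuous ρ) :
    Continuous (Function.uncurry (startedError ρ)) := by
  unfold Function.uncurry startedError
  fun_prop

theorem abs_two_mul_mul_le {a : ℝ} (ha : 0 ≤ a) (x y : ℝ) :
    |2 * x * (a * y)| ≤ a * (x ^ 2 + y ^ 2) := by
  rw [abs_le]
  constructor <;> nlinarith [mul_nonneg ha (sq_nonneg (x - y)), mul_nonneg ha (sq_nonneg (x + y))]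

theorem abs_sq_sub_sq_le_of_weights {a b : ℝ} (ha : a ∈ Icc 0 1) (hb : b ∈ Icc 0 1)
    (x u v m : ℝ) :
    |(x - b * u - a * v + a * b * m) ^ 2 - x ^ 2| ≤
      a * (2 * x ^ 2 + 4 * v ^ 2 + 4 * m ^ 2 * b) +
        b * (2 * x ^ 2 + 4 * u ^ 2 + 4 * m ^ 2 * a) := by
  obtain ⟨ha0, ha1⟩ := ha
  obtain ⟨hb0, hb1⟩ := hb
  have hab0 : 0 ≤ a * b := mul_nonneg ha0 hb0
  have hsq : ∀ {c : ℝ}, 0 ≤ c → c ≤ 1 → ∀ y : ℝ, (c * y) ^ 2 ≤ c * y ^ 2 := fun hc0 hc1 y => by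
    rw [mul_pow, sq _]
    exact mul_le_mul_of_nonneg_right (mul_le_of_le_one_left hc0 hc1) (sq_nonneg y)
  have hexpand : (x - b * u - a * v + a * b * m) ^ 2 - x ^ 2 =
      2 * x * (b * -u) + 2 * x * (a * -v) + 2 * x * (a * b * m) +
        (b * u + a * v - a * b * m) ^ 2 := by ring
  have hquad : |(b * u + a * v - a * b * m) ^ 2| ≤
      3 * (b * u ^ 2 + a * v ^ 2 + a * b * m ^ 2) := by
    rw [abs_sq]
    linarith [hsq hb0 hb1 u, hsq ha0 ha1 v, hsq hab0 (mul_le_one₀ ha1 hb0 hb1) m,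
      sq_nonneg (b * u - a * v), sq_nonneg (b * u + a * b * m), sq_nonneg (a * v + a * b * m)]
  calc _ ≤ |2 * x * (b * -u)| + |2 * x * (a * -v)| + |2 * x * (a * b * m)| +
        |(b * u + a * v - a * b * m) ^ 2| := by
        rw [hexpand]
        exact (abs_add_le _ _).trans (by gcongr; exact abs_add_three _ _ _)
    _ ≤ b * (x ^ 2 + (-u) ^ 2) + a * (x ^ 2 + (-v) ^ 2) + a * b * (x ^ 2 + m ^ 2) +
        3 * (b * u ^ 2 + a * v ^ 2 + a * b * m ^ 2) := by
        gcongr <;> apply abs_two_mul_mul_le <;> assumption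
    _ ≤ _ := by
        linarith [mul_nonneg ha0 (sq_nonneg x), mul_nonneg hab0 (sq_nonneg m),
          mul_nonneg hb0 (sq_nonneg x),
          mul_le_mul_of_nonneg_right (mul_le_of_le_one_right ha0 hb1) (sq_nonneg x)]

theorem abs_startedCov_sq_sub_le (he : ∀ x, ρ (-x) = ρ x) {r q : ℝ} (hr : 0 ≤ r) (hq : 0 ≤ q) :
    |startedCov ρ r q ^ 2 - ρ (r - q) ^ 2| ≤ startedError ρ r q + startedError ρ q r := by
  have hexp : ∀ {t : ℝ}, 0 ≤ t → exp (-t) ∈ Icc (0 : ℝ) 1 := fun ht =>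
    ⟨(exp_pos _).le, exp_le_one_iff.2 (neg_nonpos.2 ht)⟩
  rw [startedCov, startedError, startedError, ← he (q - r), neg_sub]
  exact abs_sq_sub_sq_le_of_weights (hexp hr) (hexp hq) _ _ _ _

theorem integral_startedError_le (hc : Continuous ρ) (he : ∀ x, ρ (-x) = ρ x) (hT : 0 ≤ T) :
    ∫ r in (0 : ℝ)..T, ∫ q in (0 : ℝ)..T, startedError ρ r q ≤
      8 * sqPrimitive ρ T + 4 * ρ 0 ^ 2 := by
  have hG := sqPrimitive_nonneg (ρ := ρ) hT
  have hinner : ∀ r ∈ Icc 0 T, ∫ q in (0 : ℝ)..T, startedError ρ r q ≤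
      exp (-r) * (8 * sqPrimitive ρ T + 4 * ρ 0 ^ 2) := fun r hr => by
    simp only [startedError, intervalIntegral.integral_const_mul]
    gcongr
    refine (integral_linear_combination_le hc he hr (by norm_num) (by positivity)).trans_eq ?_
    norm_num
  have hcont : Continuous fun r => ∫ q in (0 : ℝ)..T, startedError ρ r q :=
    intervalIntegral.continuous_parametric_intervalIntegral_of_continuous'
      (continuous_startedError hc) 0 T
  calc _ ≤ ∫ r in (0 : ℝ)..T, exp (-r) * (8 * sqPrimitive ρ T + 4 * ρ 0 ^ 2) :=
        intervalIntegral.integral_mono_on hT (hcont.intervalIntegrable _ _)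
          ((by fun_prop : Continuous _).intervalIntegrable _ _) hinner
    _ = (∫ r in (0 : ℝ)..T, exp (-r)) * (8 * sqPrimitive ρ T + 4 * ρ 0 ^ 2) :=
        intervalIntegral.integral_mul_const _ _
    _ ≤ _ := mul_le_of_le_one_left (by positivity) (integral_exp_neg_le T)

theorem abs_integral_startedCov_sq_sub_le (hc : Continuous ρ) (he : ∀ x, ρ (-x) = ρ x)
    (hT : 0 ≤ T) :
    |(∫ r in (0 : ℝ)..T, ∫ q in (0 : ℝ)..T, startedCov ρ r q ^ 2) -
      2 * ∫ r in (0 : ℝ)..T, sqPrimitive ρ r| ≤ 16 * sqPrimitive ρ T + 8 * ρ 0 ^ 2 := by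
  have hK : Continuous (Function.uncurry fun r q => startedCov ρ r q ^ 2) :=
    (continuous_startedCov hc).pow 2
  have hR : Continuous (Function.uncurry fun r q => ρ (r - q) ^ 2) := by
    unfold Function.uncurry
    fun_prop
  have hE := continuous_startedError hc
  have hE' : Continuous (Function.uncurry fun r q => startedError ρ q r) :=
    hE.comp continuous_swap
  have hEE : Continuous (Function.uncurry fun r q => startedError ρ r q + startedError ρ q r) :=
    hE.add hE'
  have hpar := fun {F : ℝ → ℝ → ℝ} (hF : Continuous (Function.uncurry F)) =>
    intervalIntegral.continuous_parametric_intervalIntegral_of_continuous' (μ := volume) hF 0 T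
  have hsec := fun {F : ℝ → ℝ → ℝ} (hF : Continuous (Function.uncurry F)) (r : ℝ) =>
    hF.comp (by fun_prop : Continuous fun q : ℝ => (r, q))
  have hadd : ∀ r, ∫ q in (0 : ℝ)..T, (startedError ρ r q + startedError ρ q r) =
      (∫ q in (0 : ℝ)..T, startedError ρ r q) + ∫ q in (0 : ℝ)..T, startedError ρ q r := fun r =>
    intervalIntegral.integral_add ((hsec hE r).intervalIntegrable _ _)
      ((hsec hE' r).intervalIntegrable _ _)
  rw [← integral_integral_sub_sq hc he]
  refine (abs_integral_sub_integral_le (hpar hK) (hpar hR) (hpar hEE) hT fun r hr =>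
    abs_integral_sub_integral_le (hsec hK r) (hsec hR r) (hsec hEE r) hT fun q hq =>
      abs_startedCov_sq_sub_le he hr.1 hq.1).trans ?_
  simp only [hadd]
  rw [intervalIntegral.integral_add ((hpar hE).intervalIntegrable _ _)
    ((hpar hE').intervalIntegrable _ _), integral_integral_swap_of_continuous hE']
  linarith [integral_startedError_le hc he hT]

theorem startedCov_sq_le (he : ∀ x, ρ (-x) = ρ x) (hb : ∀ x, |ρ x| ≤ ρ 0) {r q : ℝ}
    (hr : 0 ≤ r) (hq : 0 ≤ q) :
    startedCov ρ r q ^ 2 ≤ 5 * ρ (r - q) ^ 2 + 4 * ρ q ^ 2 + 12 * ρ 0 ^ 2 * exp (-q) := by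
  have hclose := (abs_le.1 (abs_startedCov_sq_sub_le he hr hq)).2
  have hu : ρ r ^ 2 ≤ ρ 0 ^ 2 := sq_le_sq' (abs_le.1 (hb r)).1 (abs_le.1 (hb r)).2
  have hrone : exp (-r) ≤ 1 := exp_le_one_iff.2 (neg_nonpos.2 hr)
  have hqone : exp (-q) ≤ 1 := exp_le_one_iff.2 (neg_nonpos.2 hq)
  have hrq : startedError ρ r q ≤ 2 * ρ (r - q) ^ 2 + 4 * ρ q ^ 2 + 4 * ρ 0 ^ 2 * exp (-q) :=
    mul_le_of_le_one_left (by positivity) hrone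
  have hqr : startedError ρ q r ≤ 2 * ρ (r - q) ^ 2 + 8 * ρ 0 ^ 2 * exp (-q) := by
    rw [startedError, ← he (q - r), neg_sub]
    calc _ ≤ exp (-q) * (2 * ρ (r - q) ^ 2 + 4 * ρ 0 ^ 2 + 4 * ρ 0 ^ 2 * 1) := by gcongr
      _ = exp (-q) * (2 * ρ (r - q) ^ 2) + 8 * ρ 0 ^ 2 * exp (-q) := by ring
      _ ≤ 2 * ρ (r - q) ^ 2 + 8 * ρ 0 ^ 2 * exp (-q) :=
        add_le_add (mul_le_of_le_one_left (by positivity) hqone) le_rfl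
  linarith

theorem integral_startedCov_sq_le (hc : Continuous ρ) (he : ∀ x, ρ (-x) = ρ x)
    (hb : ∀ x, |ρ x| ≤ ρ 0) {r : ℝ} (hr : r ∈ Icc 0 T) :
    ∫ q in (0 : ℝ)..T, startedCov ρ r q ^ 2 ≤ 14 * sqPrimitive ρ T + 12 * ρ 0 ^ 2 := by
  have hK : Continuous fun q => startedCov ρ r q ^ 2 := by
    unfold startedCov
    fun_prop
  refine (intervalIntegral.integral_mono_on (hr.1.trans hr.2) (hK.intervalIntegrable _ _)
    ((by fun_prop : Continuous _).intervalIntegrable _ _)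
    fun q hq => startedCov_sq_le he hb hr.1 hq.1).trans ?_
  refine (integral_linear_combination_le hc he hr (by norm_num) (by positivity)).trans_eq ?_
  norm_num

theorem abs_kernelEnergy_startedCov_sub_le (hc : Continuous ρ) (he : ∀ x, ρ (-x) = ρ x)
    (hb : ∀ x, |ρ x| ≤ ρ 0) (hT : 0 ≤ T) :
    |kernelEnergy (startedCov ρ) T - 8 * ∫ r in (0 : ℝ)..T, sqPrimitive ρ r| ≤
      120 * (sqPrimitive ρ T + ρ 0 ^ 2) := by
  have hbulk := abs_le.1 (abs_integral_startedCov_sq_sub_le hc he hT)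
  have hedge := integral_startedCov_sq_le hc he hb (right_mem_Icc.2 hT)
  have hedge_nonneg : 0 ≤ ∫ q in (0 : ℝ)..T, startedCov ρ T q ^ 2 :=
    intervalIntegral.integral_nonneg hT fun _ _ => sq_nonneg _
  have hcorner : startedCov ρ T T ^ 2 ≤ 21 * ρ 0 ^ 2 := by
    have h := startedCov_sq_le he hb hT hT
    have hv : ρ T ^ 2 ≤ ρ 0 ^ 2 := sq_le_sq' (abs_le.1 (hb T)).1 (abs_le.1 (hb T)).2
    have hexp := mul_le_of_le_one_right (by positivity : 0 ≤ 12 * ρ 0 ^ 2)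
      (exp_le_one_iff.2 (neg_nonpos.2 hT))
    rw [sub_self] at h
    linarith
  rw [kernelEnergy, abs_le]
  constructor <;> linarith [sq_nonneg (startedCov ρ T T), sq_nonneg (ρ 0)]

end Asymptotics

/-! ### Rates of convergence -/

section Rate

variable {ρ : ℝ → ℝ} {B γ δ T : ℝ}

theorem nonneg_of_sq_le_mul_rpow (h : ∀ x, 0 < x → ρ x ^ 2 ≤ B * x ^ γ) : 0 ≤ B :=
  (sq_nonneg _).trans <| (h 1 one_pos).trans_eq <| by rw [one_rpow, mul_one]

theorem integrableOn_sq_of_decay (hc : Continuous ρ) (hγ : 0 < γ)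
    (hdec : ∀ x, 0 < x → ρ x ^ 2 ≤ B * x ^ (-(1 + γ))) :
    IntegrableOn (fun x => ρ x ^ 2) (Ioi 0) := by
  rw [← Ioc_union_Ioi_eq_Ioi zero_le_one]
  refine ((hc.pow 2).continuousOn.integrableOn_compact isCompact_Icc).mono_set
    Ioc_subset_Icc_self |>.union ?_
  refine Integrable.mono' ((integrableOn_Ioi_rpow_of_lt (by linarith : -(1 + γ) < -1)
    one_pos).const_mul B) (hc.pow 2).aestronglyMeasurable
    (ae_restrict_of_forall_mem measurableSet_Ioi fun x hx => ?_)
  exact (norm_of_nonneg (sq_nonneg (ρ x))).trans_le <| hdec x (one_pos.trans hx)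

theorem integral_Ioi_sub_sqPrimitive (hi : IntegrableOn (fun x => ρ x ^ 2) (Ioi 0)) {r : ℝ}
    (hr : 0 ≤ r) : (∫ x in Ioi (0 : ℝ), ρ x ^ 2) - sqPrimitive ρ r = ∫ x in Ioi r, ρ x ^ 2 := by
  rw [← Ioc_union_Ioi_eq_Ioi hr, setIntegral_union (Ioc_disjoint_Ioi le_rfl) measurableSet_Ioi
    (hi.mono_set Ioc_subset_Ioi_self) (hi.mono_set (Ioi_subset_Ioi hr)), sqPrimitive,
    intervalIntegral.integral_of_le hr, add_sub_cancel_left]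

theorem sqPrimitive_le_integral_Ioi (hi : IntegrableOn (fun x => ρ x ^ 2) (Ioi 0)) {r : ℝ}
    (hr : 0 ≤ r) : sqPrimitive ρ r ≤ ∫ x in Ioi (0 : ℝ), ρ x ^ 2 := by
  rw [← sub_nonneg, integral_Ioi_sub_sqPrimitive hi hr]
  exact setIntegral_nonneg measurableSet_Ioi fun _ _ => sq_nonneg _

theorem integral_Ioi_sub_sqPrimitive_le (hc : Continuous ρ) (hγ : 0 < γ)
    (hdec : ∀ x, 0 < x → ρ x ^ 2 ≤ B * x ^ (-(1 + γ))) {r : ℝ} (hr : 0 < r) :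
    (∫ x in Ioi (0 : ℝ), ρ x ^ 2) - sqPrimitive ρ r ≤ B / γ * r ^ (-γ) := by
  have hi := integrableOn_sq_of_decay hc hγ hdec
  rw [integral_Ioi_sub_sqPrimitive hi hr.le]
  refine (setIntegral_mono_on (hi.mono_set (Ioi_subset_Ioi hr.le))
    ((integrableOn_Ioi_rpow_of_lt (by linarith : -(1 + γ) < -1) hr).const_mul B)
    measurableSet_Ioi fun x hx => hdec x (hr.trans hx)).trans_eq ?_
  rw [integral_const_mul, integral_Ioi_rpow_of_lt (by linarith) hr,
    show -(1 + γ) + 1 = -γ by ring, neg_div_neg_eq, mul_div_assoc', div_mul_eq_mul_div]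

theorem rpow_one_sub_sub_one_div_le (hγ : γ ≠ 1) (hT : 1 ≤ T) :
    (T ^ (1 - γ) - 1) / (1 - γ) ≤ T ^ (1 - min 1 γ) / |1 - γ| := by
  rcases lt_or_gt_of_ne hγ with h | h
  · rw [abs_of_pos (sub_pos.2 h), min_eq_right h.le]
    exact div_le_div_of_nonneg_right (sub_le_self _ zero_le_one) (sub_pos.2 h).le
  · rw [abs_of_neg (sub_neg.2 h), ← neg_div_neg_eq, min_eq_left h.le, sub_self, rpow_zero]
    refine div_le_div_of_nonneg_right ?_ (by linarith)
    linarith [rpow_nonneg (zero_le_one.trans hT) (1 - γ)]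

theorem integral_tail_le (hc : Continuous ρ) (hγ : 0 < γ) (hγ1 : γ ≠ 1)
    (hdec : ∀ x, 0 < x → ρ x ^ 2 ≤ B * x ^ (-(1 + γ))) (hT : 1 ≤ T) :
    ∫ r in (0 : ℝ)..T, ((∫ x in Ioi (0 : ℝ), ρ x ^ 2) - sqPrimitive ρ r) ≤
      ((∫ x in Ioi (0 : ℝ), ρ x ^ 2) + B / γ / |1 - γ|) * T ^ (1 - min 1 γ) := by
  set S := ∫ x in Ioi (0 : ℝ), ρ x ^ 2
  have hB : 0 ≤ B / γ := div_nonneg (nonneg_of_sq_le_mul_rpow hdec) hγ.le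
  have htail : ∀ a b, IntervalIntegrable (fun r => S - sqPrimitive ρ r) volume a b :=
    (continuous_const.sub (continuous_sqPrimitive hc)).intervalIntegrable
  have hnear : ∫ r in (0 : ℝ)..1, (S - sqPrimitive ρ r) ≤ S := by
    have h := intervalIntegral.integral_mono_on zero_le_one (htail 0 1)
      ((continuous_const (y := S)).intervalIntegrable (μ := volume) 0 1)
      fun r hr => sub_le_self S (sqPrimitive_nonneg hr.1)
    simpa only [intervalIntegral.integral_const, sub_zero, one_smul] using h
  have hnot : (0 : ℝ) ∉ uIcc 1 T := fun h => by
    rw [uIcc_of_le hT] at h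
    exact h.1.not_gt one_pos
  have hfar : ∫ r in (1 : ℝ)..T, (S - sqPrimitive ρ r) ≤
      B / γ * ((T ^ (1 - γ) - 1) / (1 - γ)) := by
    have h := intervalIntegral.integral_mono_on hT (htail 1 T)
      ((intervalIntegral.intervalIntegrable_rpow (μ := volume) (r := -γ)
        (Or.inr hnot)).const_mul (B / γ))
      fun r hr => integral_Ioi_sub_sqPrimitive_le hc hγ hdec (one_pos.trans_le hr.1)
    rwa [intervalIntegral.integral_const_mul, integral_rpow
      (Or.inr ⟨fun h => hγ1 (neg_injective h), hnot⟩), neg_add_eq_sub, one_rpow] at h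
  rw [← intervalIntegral.integral_add_adjacent_intervals (htail 0 1) (htail 1 T)]
  calc _ ≤ S * 1 + B / γ * (T ^ (1 - min 1 γ) / |1 - γ|) := by
        rw [mul_one]
        exact add_le_add hnear <| hfar.trans <|
          mul_le_mul_of_nonneg_left (rpow_one_sub_sub_one_div_le hγ1 hT) hB
    _ ≤ S * T ^ (1 - min 1 γ) + B / γ * (T ^ (1 - min 1 γ) / |1 - γ|) := by
        gcongr
        exact one_le_rpow hT (sub_nonneg.2 (min_le_left 1 γ))
    _ = _ := by ring

theorem exists_kernelEnergy_rate_of_decay (hc : Continuous ρ) (he : ∀ x, ρ (-x) = ρ x)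
    (hb : ∀ x, |ρ x| ≤ ρ 0) (hγ : 0 < γ) (hγ1 : γ ≠ 1)
    (hdec : ∀ x, 0 < x → ρ x ^ 2 ≤ B * x ^ (-(1 + γ))) :
    ∃ C : ℝ, 0 ≤ C ∧ ∀ T, 1 ≤ T →
      |1 / (2 * T) * kernelEnergy (startedCov ρ) T - 4 * ∫ x in Ioi (0 : ℝ), ρ x ^ 2| ≤
        C / T ^ (min 1 γ) := by
  have hi := integrableOn_sq_of_decay hc hγ hdec
  have htail := fun T (hT : 1 ≤ T) => integral_tail_le hc hγ hγ1 hdec hT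
  set S := ∫ x in Ioi (0 : ℝ), ρ x ^ 2
  have hB : 0 ≤ B := nonneg_of_sq_le_mul_rpow hdec
  refine ⟨60 * (S + ρ 0 ^ 2) + 4 * (S + B / γ / |1 - γ|), by positivity, fun T hT => ?_⟩
  have hT0 : 0 < T := one_pos.trans_le hT
  set I := ∫ r in (0 : ℝ)..T, sqPrimitive ρ r
  have hint : ∫ r in (0 : ℝ)..T, (S - sqPrimitive ρ r) = T * S - I := by
    rw [intervalIntegral.integral_sub (continuous_const.intervalIntegrable _ _)
      ((continuous_sqPrimitive hc).intervalIntegrable _ _), intervalIntegral.integral_const,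
      sub_zero, smul_eq_mul]
  have hnonneg : 0 ≤ T * S - I := hint ▸ intervalIntegral.integral_nonneg hT0.le fun r hr =>
    sub_nonneg.2 (sqPrimitive_le_integral_Ioi hi hr.1)
  have hle : T * S - I ≤ (S + B / γ / |1 - γ|) * T ^ (1 - min 1 γ) := hint ▸ htail T hT
  have henergy := abs_le.1 (abs_kernelEnergy_startedCov_sub_le hc he hb hT0.le)
  have hG := sqPrimitive_le_integral_Ioi hi hT0.le
  have hsplit : 1 / (2 * T) * kernelEnergy (startedCov ρ) T - 4 * S =
      ((kernelEnergy (startedCov ρ) T - 8 * I) / 2 - 4 * (T * S - I)) / T := by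
    field_simp
    ring
  have hpow : 1 / T ^ (min 1 γ) = T ^ (1 - min 1 γ) / T := by
    rw [rpow_sub hT0, rpow_one, div_right_comm, div_self hT0.ne']
  rw [hsplit, abs_div, abs_of_pos hT0, div_eq_mul_one_div _ (T ^ (min 1 γ)), hpow,
    ← mul_div_assoc]
  refine div_le_div_of_nonneg_right ?_ hT0.le
  have hone : 60 * (S + ρ 0 ^ 2) ≤ 60 * (S + ρ 0 ^ 2) * T ^ (1 - min 1 γ) :=
    le_mul_of_one_le_right (by positivity) (one_le_rpow hT (sub_nonneg.2 (min_le_left 1 γ)))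
  rw [abs_le]
  constructor <;> linarith

theorem sqPrimitive_le_of_growth (hc : Continuous ρ) (hδ : 0 < δ)
    (hgr : ∀ x, 0 < x → ρ x ^ 2 ≤ B * x ^ (δ - 1)) (hT : 0 ≤ T) :
    sqPrimitive ρ T ≤ B / δ * T ^ δ := by
  have h := intervalIntegral.integral_mono_on_of_le_Ioo hT
    ((hc.pow 2).intervalIntegrable (μ := volume) 0 T)
    ((intervalIntegral.intervalIntegrable_rpow' (by linarith : -1 < δ - 1)).const_mul B)
    fun x hx => hgr x hx.1
  rwa [intervalIntegral.integral_const_mul, integral_rpow (Or.inl (by linarith)),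
    sub_add_cancel, zero_rpow hδ.ne', sub_zero, mul_div_assoc', ← div_mul_eq_mul_div] at h

theorem abs_kernelEnergy_le_of_growth (hc : Continuous ρ) (he : ∀ x, ρ (-x) = ρ x)
    (hb : ∀ x, |ρ x| ≤ ρ 0) (hδ : 0 < δ)
    (hgr : ∀ x, 0 < x → ρ x ^ 2 ≤ B * x ^ (δ - 1)) (hT : 0 ≤ T) :
    |kernelEnergy (startedCov ρ) T| ≤
      (8 * T + 120) * (B / δ * T ^ δ) + 120 * ρ 0 ^ 2 := by
  have hG := sqPrimitive_le_of_growth hc hδ hgr hT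
  have hI : ∫ r in (0 : ℝ)..T, sqPrimitive ρ r ≤ T * (B / δ * T ^ δ) := by
    have h := intervalIntegral.integral_mono_on hT
      ((continuous_sqPrimitive hc).intervalIntegrable (μ := volume) 0 T)
      ((continuous_const (y := B / δ * T ^ δ)).intervalIntegrable (μ := volume) 0 T)
      fun r hr => (monotone_sqPrimitive hc hr.2).trans hG
    rwa [intervalIntegral.integral_const, sub_zero, smul_eq_mul] at h
  have hI0 : 0 ≤ ∫ r in (0 : ℝ)..T, sqPrimitive ρ r :=
    intervalIntegral.integral_nonneg hT fun r hr => sqPrimitive_nonneg hr.1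
  have henergy := abs_le.1 (abs_kernelEnergy_startedCov_sub_le hc he hb hT)
  rw [abs_le]
  constructor <;> linarith

theorem exists_kernelEnergy_rate_of_growth (hc : Continuous ρ) (he : ∀ x, ρ (-x) = ρ x)
    (hb : ∀ x, |ρ x| ≤ ρ 0) (hδ : 0 < δ)
    (hgr : ∀ x, 0 < x → ρ x ^ 2 ≤ B * x ^ (δ - 1)) (s : ℝ) {T₀ : ℝ} (hT₀ : 0 < T₀) :
    ∃ C : ℝ, 0 ≤ C ∧ ∀ T, T₀ ≤ T →
      |1 / (2 * T) * kernelEnergy (startedCov ρ) T - s| ≤ C * T ^ δ := by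
  have hB : 0 ≤ B := nonneg_of_sq_le_mul_rpow hgr
  set D := 60 * ρ 0 ^ 2 / T₀ + |s|
  refine ⟨(4 + 60 / T₀) * (B / δ) + D / T₀ ^ δ, by positivity, fun T hT => ?_⟩
  have hT0 : 0 < T := hT₀.trans_le hT
  have henergy := abs_kernelEnergy_le_of_growth hc he hb hδ hgr hT0.le
  set Q := B / δ * T ^ δ with hQ
  have hD : D ≤ D / T₀ ^ δ * T ^ δ := by
    rw [div_mul_eq_mul_div, le_div_iff₀ (rpow_pos_of_pos hT₀ δ)]
    gcongr
  calc _ ≤ |1 / (2 * T) * kernelEnergy (startedCov ρ) T| + |s| := abs_sub _ _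
    _ ≤ 1 / (2 * T) * ((8 * T + 120) * Q + 120 * ρ 0 ^ 2) + |s| := by
        rw [abs_mul, abs_of_pos (by positivity : 0 < 1 / (2 * T))]
        gcongr
    _ = 4 * Q + 60 * Q / T + 60 * ρ 0 ^ 2 / T + |s| := by
        field_simp
        ring
    _ ≤ 4 * Q + 60 * Q / T₀ + 60 * ρ 0 ^ 2 / T₀ + |s| := by gcongr
    _ = (4 + 60 / T₀) * (B / δ) * T ^ δ + D := by
        rw [hQ]
        ring
    _ ≤ (4 + 60 / T₀) * (B / δ) * T ^ δ + D / T₀ ^ δ * T ^ δ := by gcongr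
    _ = _ := by ring

end Rate

section FractionalOrnsteinUhlenbeck

variable {H : ℝ}

theorem ouCov_sq_le (h0 : 0 < H) (h1 : H < 1) {x : ℝ} (hx : 0 < x) :
    ouCov H x ^ 2 ≤ x ^ (4 * H - 4) := by
  refine (sq_le_sq.2 ((abs_ouCov_le h0 h1 hx).trans (le_abs_self _))).trans_eq ?_
  rw [← rpow_mul_natCast hx.le]
  congr 1
  push_cast
  ring

theorem ouCov_half_sq_le {x : ℝ} (hx : 0 < x) : ouCov (1 / 2) x ^ 2 ≤ 9 * x ^ (-(4 : ℝ)) := by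
  refine (sq_le_sq.2 ((abs_ouCov_half_le hx).trans (le_abs_self _))).trans_eq ?_
  rw [mul_pow, ← rpow_mul_natCast hx.le]
  norm_num

theorem exists_kernelEnergy_ouCov_rate_of_one_le (h0 : 0 < H) (h1 : H < 3 / 4) :
    ∃ C : ℝ, 0 ≤ C ∧ ∀ T, 1 ≤ T →
      |1 / (2 * T) * kernelEnergy (startedCov (ouCov H)) T - sigmaSq H| ≤
        C / T ^ (min 1 (3 - 4 * H)) := by
  have hH1 : H < 1 := by linarith
  rw [← four_mul_integral_ouCov_sq h0 h1]
  have hc := continuous_ouCov h0 hH1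
  have hb := abs_ouCov_le_ouCov_zero h0 hH1
  -- At `H = 1/2` the generic decay `x^(2H-2)` would cost a logarithm, so the faster one is used.
  rcases eq_or_ne H (1 / 2) with rfl | hhalf
  · convert exists_kernelEnergy_rate_of_decay hc (ouCov_neg _) hb three_pos (by norm_num)
      (B := 9) fun x hx => (ouCov_half_sq_le hx).trans_eq (by norm_num) using 8
    norm_num
  · exact exists_kernelEnergy_rate_of_decay hc (ouCov_neg H) hb (by linarith)
      (fun h => hhalf (by linarith)) (B := 1) fun x hx => (ouCov_sq_le h0 hH1 hx).trans_eq <| by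
        rw [one_mul]
        ring_nf

theorem kernelEnergy_startedCov_ouCov_mem_Icc (h0 : 0 < H) (h1 : H < 1) {T : ℝ}
    (hT : T ∈ Icc 0 1) :
    kernelEnergy (startedCov (ouCov H)) T ∈ Icc 0 (144 * T ^ (4 * H)) := by
  obtain ⟨hT0, hT1⟩ := hT
  obtain ⟨h, hh, -⟩ := existsUnique_isElement_fT ⟨H, h0, h1⟩ hT0
  rw [← hh.norm_sq_eq _ hT0]
  refine ⟨sq_nonneg _, (hh.norm_sq_le _ hT0).trans ?_⟩
  calc _ ≤ (2 * 1 + 1) ^ 2 * (16 * T ^ (4 * H)) := by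
        gcongr
    _ = _ := by ring

theorem abs_kernelEnergy_ouCov_sub_sigmaSq_le_of_le_one (h0 : 0 < H) (h1 : H < 3 / 4) {T : ℝ}
    (hT : T ∈ Ioc 0 1) :
    |1 / (2 * T) * kernelEnergy (startedCov (ouCov H)) T - sigmaSq H| ≤
      (72 + |sigmaSq H|) / T ^ (min 1 (3 - 4 * H)) := by
  obtain ⟨hT0, hT1⟩ := hT
  obtain ⟨hE0, hE⟩ := kernelEnergy_startedCov_ouCov_mem_Icc h0 (by linarith) ⟨hT0.le, hT1⟩
  set E := kernelEnergy (startedCov (ouCov H)) T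
  set γ := min 1 (3 - 4 * H)
  have hγ0 : 0 < γ := lt_min one_pos (by linarith)
  have hpow : T ^ (4 * H) / T ≤ 1 / T ^ γ := by
    rw [one_div, ← rpow_neg hT0.le, ← rpow_sub_one hT0.ne']
    refine rpow_le_rpow_of_exponent_ge hT0 hT1 ?_
    rcases min_choice 1 (3 - 4 * H) with h | h <;> linarith
  have hone : 1 ≤ 1 / T ^ γ :=
    (one_le_div (rpow_pos_of_pos hT0 γ)).2 (rpow_le_one hT0.le hT1 hγ0.le)
  calc _ ≤ |1 / (2 * T) * E| + |sigmaSq H| := abs_sub _ _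
    _ = 1 / (2 * T) * E + |sigmaSq H| := by rw [abs_of_nonneg (by positivity)]
    _ ≤ 1 / (2 * T) * (144 * T ^ (4 * H)) + |sigmaSq H| := by gcongr
    _ = 72 * (T ^ (4 * H) / T) + |sigmaSq H| * 1 := by
        field_simp
        ring
    _ ≤ 72 * (1 / T ^ γ) + |sigmaSq H| * (1 / T ^ γ) := by gcongr
    _ = _ := by ring

theorem exists_kernelEnergy_ouCov_rate_of_lt (h0 : 0 < H) (h1 : H < 3 / 4) :
    ∃ C : ℝ, 0 < C ∧ ∀ T, 0 < T →
      |1 / (2 * T) * kernelEnergy (startedCov (ouCov H)) T - sigmaSq H| ≤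
        C / T ^ (min 1 (3 - 4 * H)) := by
  obtain ⟨C, hC, hlong⟩ := exists_kernelEnergy_ouCov_rate_of_one_le h0 h1
  refine ⟨C + (72 + |sigmaSq H|), by positivity, fun T hT => ?_⟩
  rcases le_total 1 T with hT1 | hT1
  · exact (hlong T hT1).trans
      (div_le_div_of_nonneg_right (le_add_of_nonneg_right (by positivity)) (rpow_nonneg hT.le _))
  · exact (abs_kernelEnergy_ouCov_sub_sigmaSq_le_of_le_one h0 h1 ⟨hT, hT1⟩).trans
      (div_le_div_of_nonneg_right (le_add_of_nonneg_left hC) (rpow_nonneg hT.le _))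

theorem exists_kernelEnergy_ouCov_rate_of_gt (h1 : 3 / 4 < H) (hH1 : H < 1) {T₀ : ℝ}
    (hT₀ : 0 < T₀) :
    ∃ C : ℝ, 0 < C ∧ ∀ T, T₀ ≤ T →
      |1 / (2 * T) * kernelEnergy (startedCov (ouCov H)) T - sigmaSq H| ≤
        C / T ^ (min 1 (3 - 4 * H)) := by
  have h0 : 0 < H := by linarith
  obtain ⟨C, hC, hrate⟩ := exists_kernelEnergy_rate_of_growth (δ := 4 * H - 3) (B := 1)
    (continuous_ouCov h0 hH1) (ouCov_neg H) (abs_ouCov_le_ouCov_zero h0 hH1) (by linarith)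
    (fun x hx => (ouCov_sq_le h0 hH1 hx).trans_eq <| by
      rw [one_mul]
      ring_nf) (sigmaSq H) hT₀
  refine ⟨C + 1, by positivity, fun T hT => (hrate T hT).trans ?_⟩
  have hT0 : 0 ≤ T := (hT₀.trans_le hT).le
  rw [min_eq_right (by linarith), ← neg_sub (4 * H) 3, rpow_neg hT0, div_inv_eq_mul]
  gcongr
  exact le_add_of_nonneg_right zero_le_one

end FractionalOrnsteinUhlenbeck

end FBM

end

theorem mainTheorem2 (H : ℝ) (hH : H ∈ Set.Ioo (0 : ℝ) 1) (hH' : H ≠ 3 / 4) :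
    (∀ T : ℝ, 0 < T → ∃! h : FBM.TensorSquare ⟨H, hH⟩ T, FBM.IsElement ⟨H, hH⟩ T (FBM.fT T) h) ∧
    (∀ T₀ : ℝ, 0 < T₀ → ∃ C : ℝ, 0 < C ∧ ∀ T : ℝ, T₀ ≤ T →
      ∀ h : FBM.TensorSquare ⟨H, hH⟩ T, FBM.IsElement ⟨H, hH⟩ T (FBM.fT T) h →
        |1 / (2 * T) * ‖h‖ ^ 2 - FBM.sigmaSq H| ≤ C / T ^ (min 1 (3 - 4 * H))) ∧
    (H < 3 / 4 → ∃ C : ℝ, 0 < C ∧ ∀ T : ℝ, 0 < T →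
      ∀ h : FBM.TensorSquare ⟨H, hH⟩ T, FBM.IsElement ⟨H, hH⟩ T (FBM.fT T) h →
        |1 / (2 * T) * ‖h‖ ^ 2 - FBM.sigmaSq H| ≤ C / T ^ (min 1 (3 - 4 * H))) := by
  have rate_transfer : ∀ {C T : ℝ}, 0 < T →
      |1 / (2 * T) * FBM.kernelEnergy (FBM.startedCov (FBM.ouCov H)) T - FBM.sigmaSq H| ≤
        C / T ^ (min 1 (3 - 4 * H)) →
      ∀ h : FBM.TensorSquare ⟨H, hH⟩ T, FBM.IsElement ⟨H, hH⟩ T (FBM.fT T) h →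
        |1 / (2 * T) * ‖h‖ ^ 2 - FBM.sigmaSq H| ≤ C / T ^ (min 1 (3 - 4 * H)) :=
    fun hT hrate _ hh => (hh.norm_sq_eq ⟨H, hH⟩ hT.le).symm ▸ hrate
  refine ⟨fun T hT => FBM.existsUnique_isElement_fT ⟨H, hH⟩ hT.le, fun T₀ hT₀ => ?_, fun hlt => ?_⟩
  · rcases lt_or_gt_of_ne hH' with hlt | hgt
    · obtain ⟨C, hC, hrate⟩ := FBM.exists_kernelEnergy_ouCov_rate_of_lt hH.1 hlt
      exact ⟨C, hC, fun T hT => rate_transfer (hT₀.trans_le hT) (hrate T (hT₀.trans_le hT))⟩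
    · obtain ⟨C, hC, hrate⟩ := FBM.exists_kernelEnergy_ouCov_rate_of_gt hgt hH.2 hT₀
      exact ⟨C, hC, fun T hT => rate_transfer (hT₀.trans_le hT) (hrate T hT)⟩
  · obtain ⟨C, hC, hrate⟩ := FBM.exists_kernelEnergy_ouCov_rate_of_lt hH.1 hlt
    exact ⟨C, hC, fun T hT => rate_transfer hT (hrate T hT)⟩
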